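/- Let $N,d\ge 2$ and let $X=(X_1,\dots,X_d)$ be a family of locally Lipschitz vector fields on $\mathbb R^N$; for a function $u$ write $Xu=(X_1u,\dots,X_du)$. Let $\delta$ be the associated Carnot–Carathéodory distance, i.e. $\delta(x,y)$ is the infimum of the $T>0$ for which there is an absolutely continuous $\gamma:[0,T]\to\mathbb R^N$ with $\gamma(0)=x$, $\gamma(T)=y$ and, for a.e. $t$, $\dot\gamma(t)=\sum_j\theta_jX_j(\gamma(t))$ with $\sum_j\theta_j^2\le1$. Assume that: * any two points of $\mathbb R^N$ are joined by such a path, and $|y-x|\to0\iff\delta(x,y)\to0$; * for some $Q>0$, $0<|B_{2r}|\le 2^Q|B_r|$ for all concentric $\delta$-balls $B_r,B_{2r}$ of radii $r,2r>0$; * there are $C_P,\nu>0$ such that, for every $\delta$-ball $B_r$ and every $u$ of class $C^1$ on (a neighbourhood of) $\overline{B_{\nu r}}$ and integrable on $B_r$, with mean $u_r$ over $B_r$, $\frac1{|B_r|}\int_{B_r}|u-u_r|\,dx\le C_P\,r\,\frac1{|B_{\nu r}|}\int_{B_{\nu r}}|Xu|\,dx$, where $B_{\nu r}$ is concentric with $B_r$.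 Let $\Omega\subset\mathbb R^N$ be open and bounded, and let $1<p<Q$, $\alpha>0$. For $\beta>0$ and $h\in L^{p'}(\Omega)$, $p'=\frac p{p-1}$, consider Carathéodory functions $a:\Omega\times\mathbb R\times\mathbb R^d\to\mathbb R^d$ such that for a.e. $x\in\Omega$, all $s\in\mathbb R$ and all $\xi\ne\eta$ in $\mathbb R^d$, $$a(x,s,\xi)\cdot\xi\ge\alpha|\xi|^p,\qquad |a(x,s,\xi)|\le\beta\,(h(x)+|s|^{p-1}+|\xi|^{p-1}),\qquad [a(x,s,\xi)-a(x,s,\eta)]\cdot(\xi-\eta)>0.$$ Let $W^{1,p}_0(\Omega,X)$ be the closure of $C_c^\infty(\Omega)$ in the norm $\|Xu\|_{L^p(\Omega)}$, realized as a space of functions: $u\in W^{1,p}_0(\Omega,X)$ with $X$-gradient $Xu=V$ if $u\in L^p(\Omega)$, $V\in L^p(\Omega)^d$ and there are $\varphi_n\in C_c^\infty(\Omega)$ with $\varphi_n\to u$ and $X\varphi_n\to V$ in $L^p(\Omega)$. A weak solution of $$X^*a(x,u,Xu)=f\ \text{ in }\Omega,\qquad u=0\ \text{ on }\partial\Omega$$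 is a function $u\in W_0^{1,p}(\Omega,X)$ with $\int_\Omega a(x,u,Xu)\cdot Xv=\int_\Omega fv$ for all $v\in W_0^{1,p}(\Omega,X)$. **Theorem 4.2.** Write $q^*=\frac{qQ}{Q-q}$ for $1\le q<Q$, and let $$p_*=\frac{pQ}{Q(p-1)+p}\le m<\frac Qp,\qquad s=\frac{m(p-1)Q}{Q-mp}.$$ Then $s=[m^*(p-1)]^*$, and there is a constant $C>0$ depending only on $Q,p,\Omega,\alpha,m,X$ such that, for all $\beta,h,a$ as above and all $f\in L^m(\Omega)$, every weak solution $u$ belongs to $L^s(\Omega)$ and $$\|u\|_{L^s(\Omega)}\le C\,\|f\|_{L^m(\Omega)}^{\frac1{p-1}}.$$ -/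

import Mathlib

open MeasureTheory Filter Topology Set
open scoped ContDiff ENNReal

noncomputable section

/-- The `X`-gradient `Xu = (X_1 u, ..., X_d u)` of a function `u` on `ℝ^N`, where
`X_j u (x) = ∑_k c_{jk}(x) ∂_k u (x)` is the derivative of `u` at `x` along the vector `X_j(x)`. -/
def xGrad {N d : ℕ} (X : Fin d → EuclideanSpace ℝ (Fin N) → EuclideanSpace ℝ (Fin N))
    (u : EuclideanSpace ℝ (Fin N) → ℝ) (x : EuclideanSpace ℝ (Fin N)) :
    EuclideanSpace ℝ (Fin d) :=
  WithLp.toLp 2 (fun j => fderiv ℝ u x (X j x))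

/-- `γ : [0, T] → ℝ^N` is `X`-subunit: it is absolutely continuous, and for almost every `t` one has
`γ'(t) = ∑_j θ_j X_j(γ(t))` with `∑_j θ_j² ≤ 1`. -/
def IsSubunit {N d : ℕ} (X : Fin d → EuclideanSpace ℝ (Fin N) → EuclideanSpace ℝ (Fin N))
    (T : ℝ) (γ : ℝ → EuclideanSpace ℝ (Fin N)) : Prop :=
  AbsolutelyContinuousOnInterval γ 0 T ∧
    ∀ᵐ t ∂(volume.restrict (Icc 0 T)), ∃ θ : Fin d → ℝ,
      ∑ j, θ j ^ 2 ≤ 1 ∧ HasDerivAt γ (∑ j, θ j • X j (γ t)) t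

/-- The times `T > 0` in which `y` can be reached from `x` along an `X`-subunit path. -/
def travelTimes {N d : ℕ} (X : Fin d → EuclideanSpace ℝ (Fin N) → EuclideanSpace ℝ (Fin N))
    (x y : EuclideanSpace ℝ (Fin N)) : Set ℝ :=
  {T | 0 < T ∧ ∃ γ : ℝ → EuclideanSpace ℝ (Fin N), IsSubunit X T γ ∧ γ 0 = x ∧ γ T = y}

/-- The Carnot–Carathéodory (control) distance. It is used only when all pairs of points can be
joined by subunit paths, so that the infimum is over a non-empty set. -/
def ccDist {N d : ℕ} (X : Fin d → EuclideanSpace ℝ (Fin N) → EuclideanSpace ℝ (Fin N))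
    (x y : EuclideanSpace ℝ (Fin N)) : ℝ :=
  sInf (travelTimes X x y)

/-- Balls of the control distance. -/
def ccBall {N d : ℕ} (X : Fin d → EuclideanSpace ℝ (Fin N) → EuclideanSpace ℝ (Fin N))
    (x : EuclideanSpace ℝ (Fin N)) (r : ℝ) : Set (EuclideanSpace ℝ (Fin N)) :=
  {y | ccDist X x y < r}

/-- The `(1,1)`-Poincaré inequality on all control balls, for functions that are `C¹` on (a
neighbourhood of) the closed ball `\overline{B_{νr}}`. The averages are `[0, ∞]`-valued; integrability
of `u` is only asked for so that the mean `u_r` makes sense (it is automatic for relatively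
compact balls). -/
def PoincareInequality {N d : ℕ}
    (X : Fin d → EuclideanSpace ℝ (Fin N) → EuclideanSpace ℝ (Fin N)) : Prop :=
  ∃ C_P ν : ℝ, 0 < C_P ∧ 0 < ν ∧
    ∀ (x₀ : EuclideanSpace ℝ (Fin N)) (r : ℝ), 0 < r →
      ∀ (u : EuclideanSpace ℝ (Fin N) → ℝ) (U : Set (EuclideanSpace ℝ (Fin N))),
        IsOpen U → closure (ccBall X x₀ (ν * r)) ⊆ U → ContDiffOn ℝ 1 u U →
        IntegrableOn u (ccBall X x₀ r) volume →
          (⨍⁻ x in ccBall X x₀ r, ‖u x - (⨍ y in ccBall X x₀ r, u y ∂volume)‖ₑ ∂volume) ≤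
            ENNReal.ofReal (C_P * r) *
              (⨍⁻ x in ccBall X x₀ (ν * r), ‖xGrad X u x‖ₑ ∂volume)

/-- The geometric assumptions on the family `X` of vector fields on `ℝ^N`, with doubling
exponent `Q`. -/
structure GeometricAssumptions {N d : ℕ}
    (X : Fin d → EuclideanSpace ℝ (Fin N) → EuclideanSpace ℝ (Fin N)) (Q : ℝ) : Prop where
  locallyLipschitz : ∀ j, LocallyLipschitz (X j)
  /-- any two points are joined by a subunit path -/
  connected : ∀ x y, (travelTimes X x y).Nonempty
  /-- the control distance and the Euclidean distance have the same convergent sequences -/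
  topology : ∀ (x : EuclideanSpace ℝ (Fin N)) (y : ℕ → EuclideanSpace ℝ (Fin N)),
    Tendsto y atTop (𝓝 x) ↔ Tendsto (fun n => ccDist X x (y n)) atTop (𝓝 0)
  Q_pos : 0 < Q
  doubling : ∀ (x : EuclideanSpace ℝ (Fin N)) (r : ℝ), 0 < r →
    0 < volume (ccBall X x (2 * r)) ∧
      volume (ccBall X x (2 * r)) ≤ ENNReal.ofReal (2 ^ Q) * volume (ccBall X x r)
  poincare : PoincareInequality X

/-- `u ∈ W^{1,p}_0(Ω, X)` with `X`-gradient `Xu = V`: there are `φ_n ∈ C^∞_c(Ω)` such that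
`Xφ_n → V` in `L^p(Ω)` and `φ_n → u` in `L^p(Ω)`.
Here `V` is determined by `u` up to null sets (integrate by parts against test functions; the
coefficients of `X` are locally Lipschitz) and it is the distributional `X`-gradient of `u`. -/
def IsSobolevZero {N d : ℕ} (X : Fin d → EuclideanSpace ℝ (Fin N) → EuclideanSpace ℝ (Fin N))
    (Ω : Set (EuclideanSpace ℝ (Fin N))) (p : ℝ) (u : EuclideanSpace ℝ (Fin N) → ℝ)
    (V : EuclideanSpace ℝ (Fin N) → EuclideanSpace ℝ (Fin d)) : Prop :=
  MemLp u (ENNReal.ofReal p) (volume.restrict Ω) ∧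
  MemLp V (ENNReal.ofReal p) (volume.restrict Ω) ∧
  ∃ φ : ℕ → EuclideanSpace ℝ (Fin N) → ℝ,
    (∀ n, ContDiff ℝ ∞ (φ n) ∧ HasCompactSupport (φ n) ∧ tsupport (φ n) ⊆ Ω) ∧
    Tendsto (fun n => eLpNorm (fun x => φ n x - u x) (ENNReal.ofReal p) (volume.restrict Ω))
      atTop (𝓝 0) ∧
    Tendsto (fun n => eLpNorm (fun x => xGrad X (φ n) x - V x) (ENNReal.ofReal p)
      (volume.restrict Ω)) atTop (𝓝 0)

/-- The structural assumptions on `a : Ω × ℝ × ℝ^d → ℝ^d`: it is a Carathéodory function, and for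
almost every `x ∈ Ω` it is coercive with constant `α`, has `(p-1)`-growth with constant `β` and
`h ∈ L^{p'}(Ω)`, and is strictly monotone in its last variable. -/
structure LerayLions {N d : ℕ} (Ω : Set (EuclideanSpace ℝ (Fin N))) (p α β : ℝ)
    (h : EuclideanSpace ℝ (Fin N) → ℝ)
    (a : EuclideanSpace ℝ (Fin N) → ℝ → EuclideanSpace ℝ (Fin d) → EuclideanSpace ℝ (Fin d)) :
    Prop where
  measurable : ∀ s ξ, AEStronglyMeasurable (fun x => a x s ξ) (volume.restrict Ω)
  continuous : ∀ᵐ x ∂(volume.restrict Ω),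
    Continuous (fun q : ℝ × EuclideanSpace ℝ (Fin d) => a x q.1 q.2)
  h_memLp : MemLp h (ENNReal.ofReal (p / (p - 1))) (volume.restrict Ω)
  coercive : ∀ᵐ x ∂(volume.restrict Ω), ∀ s ξ, α * ‖ξ‖ ^ p ≤ inner ℝ (a x s ξ) ξ
  growth : ∀ᵐ x ∂(volume.restrict Ω), ∀ s ξ,
    ‖a x s ξ‖ ≤ β * (h x + |s| ^ (p - 1) + ‖ξ‖ ^ (p - 1))
  monotone : ∀ᵐ x ∂(volume.restrict Ω), ∀ s ξ η, ξ ≠ η →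
    0 < inner ℝ (a x s ξ - a x s η) (ξ - η)

/-- `u` is a weak solution of `X^* a(x, u, Xu) = f` in `Ω`, `u = 0` on `∂Ω`:
`u ∈ W^{1,p}_0(Ω, X)` and `∫_Ω a(x, u, Xu) · Xv = ∫_Ω f v` for all `v ∈ W^{1,p}_0(Ω, X)`. -/
def IsWeakSolution {N d : ℕ} (X : Fin d → EuclideanSpace ℝ (Fin N) → EuclideanSpace ℝ (Fin N))
    (Ω : Set (EuclideanSpace ℝ (Fin N))) (p : ℝ)
    (a : EuclideanSpace ℝ (Fin N) → ℝ → EuclideanSpace ℝ (Fin d) → EuclideanSpace ℝ (Fin d))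
    (f u : EuclideanSpace ℝ (Fin N) → ℝ) : Prop :=
  ∃ V : EuclideanSpace ℝ (Fin N) → EuclideanSpace ℝ (Fin d),
    IsSobolevZero X Ω p u V ∧
    ∀ (v : EuclideanSpace ℝ (Fin N) → ℝ) (W : EuclideanSpace ℝ (Fin N) → EuclideanSpace ℝ (Fin d)),
      IsSobolevZero X Ω p v W →
        ∫ x in Ω, inner ℝ (a x (u x) (V x)) (W x) = ∫ x in Ω, f x * v x

/-- The Sobolev exponent `q^* = qQ / (Q - q)` in dimension `Q` (used for `1 ≤ q < Q`). -/
def sobolevExponent (Q q : ℝ) : ℝ := q * Q / (Q - q)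

/-- The exponent `p_* = pQ / (Q(p-1) + p)`, the Hölder conjugate of `p^*`. -/
def lowerSobolevExponent (Q p : ℝ) : ℝ := p * Q / (Q * (p - 1) + p)

end

/-! The proof tests the equation with truncated powers of the solution. For w(t) = min(|t|, k)^q put
H = ∫_0^u w and G = ∫_0^u w^p; both lie in W^{1,p}_0 by `IsSobolevZero.comp_primitive`. Testing with
G and coercivity bound α‖XH‖_p^p by ∫ |f||G|, and Sobolev's inequality bounds ‖H‖_{p^*} by ‖XH‖_p.
Pointwise |G| ≤ c|H|^σ with σ = q(p-1)/(q+1) + 1 < p, so Hölder with exponents m and m' gives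
‖H‖_{p^*}^p ≤ K‖f‖_m ‖H‖_{p^*}^σ as soon as σm' = p^*. This fixes q, and m ≥ p_* says exactly that q
≥ 0. Truncation makes ‖H‖_{p^*} finite, so the power σ can be absorbed. Since min(|u|, k)^(q+1) ≤
(q+1)|H|, letting k → ∞ gives the estimate with s = p^*(q+1) (`LerayLions.eLpNorm_le`). The growth
condition serves only to make the pairings integrable, so β and h do not enter the constant.

Sobolev's inequality follows from doubling and Poincaré (`IsDoublingWith.exists_sobolev`), since the
control distance is a pseudometric inducing the Euclidean topology. The means of a test function
over balls B(x, 2^{-i}R) telescope to its value at x. The largest ball has at least twice the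
measure of Ω, so the function vanishes on half of it and the first mean is controlled as well. Each
term is bounded by the maximal function M|Xφ| and, through Hölder and a lower volume bound, by
‖Xφ‖_p. Balancing the two as Hedberg does yields |φ| ≤ A‖Xφ‖_p^{p/Q} (M|Xφ|)^{1-p/Q}, and the strong
(p,p) bound for M concludes. -/

noncomputable section

/-! ### Cutting, shifting and reversing absolutely continuous paths -/

namespace AbsolutelyContinuousOnInterval

variable {Y : Type*} [PseudoMetricSpace Y] {f g : ℝ → Y} {a b c : ℝ}

lemma congr_of_eqOn (hf : AbsolutelyContinuousOnInterval f a b) (hfg : EqOn f g (uIcc a b)) :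
    AbsolutelyContinuousOnInterval g a b := by
  rw [absolutelyContinuousOnInterval_iff] at hf ⊢
  intro ε hε
  obtain ⟨δ, hδ, H⟩ := hf ε hε
  refine ⟨δ, hδ, fun E hE hlt => ?_⟩
  convert H E hE hlt using 2 with i hi
  rw [hfg (hE.1 i hi).1, hfg (hE.1 i hi).2]

/-- Absolute continuity on adjacent intervals gives absolute continuity on their union. -/
lemma trans_of_le (hf : AbsolutelyContinuousOnInterval f a b)
    (hf' : AbsolutelyContinuousOnInterval f b c) (hab : a ≤ b) (hbc : b ≤ c) :
    AbsolutelyContinuousOnInterval f a c := by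
  rw [absolutelyContinuousOnInterval_iff] at hf hf' ⊢
  intro ε hε
  obtain ⟨δ₁, hδ₁, H₁⟩ := hf (ε / 2) (half_pos hε)
  obtain ⟨δ₂, hδ₂, H₂⟩ := hf' (ε / 2) (half_pos hε)
  refine ⟨min δ₁ δ₂, lt_min hδ₁ hδ₂, fun E hE hlt => ?_⟩
  obtain ⟨n, I⟩ := E
  have hmem := hE.1
  have hdisj := hE.2
  simp only at hmem hdisj hlt ⊢
  -- Intervals are clipped to the left of `b` here and to the right of `b` in `K₂`. Clipping only
  -- shrinks them, so disjointness and the length bound persist.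
  have K₁ := H₁ (n, fun i => (min (I i).1 b, min (I i).2 b)) (by
    refine ⟨fun i hi => ?_, fun i hi j hj hij => ?_⟩
    · have := hmem i hi
      simp only [uIcc_of_le hab, uIcc_of_le (hab.trans hbc), mem_Icc] at this ⊢
      grind
    · refine Disjoint.mono ?_ ?_ (hdisj hi hj hij) <;>
      · intro x hx
        simp only [mem_uIoc] at hx ⊢
        grind) (by
    refine lt_of_le_of_lt (Finset.sum_le_sum fun i _ => ?_) (hlt.trans_le (min_le_left _ _))
    simp only [Real.dist_eq]
    grind)
  have K₂ := H₂ (n, fun i => (max (I i).1 b, max (I i).2 b)) (by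
    refine ⟨fun i hi => ?_, fun i hi j hj hij => ?_⟩
    · have := hmem i hi
      simp only [uIcc_of_le hbc, uIcc_of_le (hab.trans hbc), mem_Icc] at this ⊢
      grind
    · refine Disjoint.mono ?_ ?_ (hdisj hi hj hij) <;>
      · intro x hx
        simp only [mem_uIoc] at hx ⊢
        grind) (by
    refine lt_of_le_of_lt (Finset.sum_le_sum fun i _ => ?_) (hlt.trans_le (min_le_right _ _))
    simp only [Real.dist_eq]
    grind)
  calc ∑ i ∈ Finset.range n, dist (f (I i).1) (f (I i).2)
      ≤ ∑ i ∈ Finset.range n, (dist (f (min (I i).1 b)) (f (min (I i).2 b)) +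
          dist (f (max (I i).1 b)) (f (max (I i).2 b))) := by
        refine Finset.sum_le_sum fun i _ => ?_
        rcases le_total (I i).1 b with h1 | h1 <;> rcases le_total (I i).2 b with h2 | h2 <;>
          simp only [h1, h2, min_eq_left, min_eq_right, max_eq_left, max_eq_right, dist_self,
            add_zero, zero_add, le_refl]
        · exact dist_triangle _ _ _
        · rw [add_comm]
          exact dist_triangle _ _ _
    _ < ε := by
        rw [Finset.sum_add_distrib]
        simp only at K₁ K₂
        linarith

lemma comp_sub_const (hf : AbsolutelyContinuousOnInterval f a b) (c : ℝ) :
    AbsolutelyContinuousOnInterval (fun t => f (t - c)) (a + c) (b + c) := by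
  rw [absolutelyContinuousOnInterval_iff] at hf ⊢
  intro ε hε
  obtain ⟨δ, hδ, H⟩ := hf ε hε
  refine ⟨δ, hδ, fun E hE hlt => ?_⟩
  refine H (E.1, fun i => ((E.2 i).1 - c, (E.2 i).2 - c)) ⟨fun i hi => ?_, fun i hi j hj hij => ?_⟩
    (by simpa using hlt)
  · have := hE.1 i hi
    simp only [mem_uIcc] at this ⊢
    grind
  · have := hE.2 hi hj hij
    simp only [Function.onFun, Set.disjoint_left, mem_uIoc] at this ⊢
    intro x
    specialize @this (x + c)
    grind

lemma comp_const_sub (hf : AbsolutelyContinuousOnInterval f a b) (c : ℝ) :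
    AbsolutelyContinuousOnInterval (fun t => f (c - t)) (c - b) (c - a) := by
  rw [absolutelyContinuousOnInterval_iff] at hf ⊢
  intro ε hε
  obtain ⟨δ, hδ, H⟩ := hf ε hε
  refine ⟨δ, hδ, fun E hE hlt => ?_⟩
  refine H (E.1, fun i => (c - (E.2 i).1, c - (E.2 i).2)) ⟨fun i hi => ?_, fun i hi j hj hij => ?_⟩
    (by simpa only [dist_sub_left] using hlt)
  · have := hE.1 i hi
    simp only [mem_uIcc] at this ⊢
    grind
  · have := hE.2 hi hj hij
    simp only [Function.onFun, uIoc, Ioc_disjoint_Ioc] at this ⊢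
    grind

end AbsolutelyContinuousOnInterval

/-- The explicit form lets the metric structure be passed by hand, for use with the control
pseudometric. -/
lemma PseudoMetricSpace.nhds_isCountablyGenerated {Y : Type*} [PseudoMetricSpace Y] (x : Y) :
    (𝓝 x).IsCountablyGenerated := inferInstance

/-! ### The control distance as a pseudometric for the Euclidean topology -/

section ControlDistance

variable {N d : ℕ} {X : Fin d → EuclideanSpace ℝ (Fin N) → EuclideanSpace ℝ (Fin N)}
  {x y z : EuclideanSpace ℝ (Fin N)} {S T : ℝ}

/-- Time reversal: the controls change sign, which leaves the sum of their squares unchanged. -/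
lemma travelTimes_symm (hT : T ∈ travelTimes X x y) : T ∈ travelTimes X y x := by
  obtain ⟨hT, γ, ⟨hac, hder⟩, h0, h1⟩ := hT
  refine ⟨hT, fun t => γ (T - t), ⟨by simpa using hac.comp_const_sub T, ?_⟩, by simpa, by simpa⟩
  rw [ae_restrict_iff' measurableSet_Icc] at hder ⊢
  filter_upwards [(Measure.measurePreserving_sub_left volume T).quasiMeasurePreserving.ae hder]
    with t ht htmem
  obtain ⟨θ, hθ, hd⟩ := ht ⟨by linarith [htmem.2], by linarith [htmem.1]⟩
  refine ⟨fun j => -θ j, by simpa using hθ, ?_⟩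
  have := hd.comp_const_sub T t
  simpa [neg_smul, Finset.sum_neg_distrib] using this

lemma travelTimes_add (hS : S ∈ travelTimes X x y) (hT : T ∈ travelTimes X y z) :
    S + T ∈ travelTimes X x z := by
  obtain ⟨hS, γ, ⟨hac, hder⟩, h0, h1⟩ := hS
  obtain ⟨hT, η, ⟨hac', hder'⟩, h0', h1'⟩ := hT
  refine ⟨add_pos hS hT, fun t => if t ≤ S then γ t else η (t - S), ⟨?_, ?_⟩, ?_, ?_⟩
  · refine AbsolutelyContinuousOnInterval.trans_of_le (b := S) ?_ ?_ hS.le (by linarith)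
    · refine hac.congr_of_eqOn fun t ht => ?_
      rw [uIcc_of_le hS.le] at ht
      simp [ht.2]
    · have := hac'.comp_sub_const S
      rw [zero_add, add_comm T S] at this
      refine this.congr_of_eqOn fun t ht => ?_
      rw [uIcc_of_le (by linarith)] at ht
      rcases ht.1.eq_or_lt with rfl | h
      · simp [h0', h1]
      · simp [h.not_ge]
  · rw [ae_restrict_iff' measurableSet_Icc] at hder hder' ⊢
    -- The junction time `S`, where the concatenated path may fail to be differentiable, is a null
    -- set.
    filter_upwards [hder, (measurePreserving_sub_right volume S).quasiMeasurePreserving.ae hder',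
      compl_mem_ae_iff.2 (measure_singleton S)] with t ht ht' hne htmem
    rcases lt_or_gt_of_ne (show t ≠ S from hne) with h | h
    · obtain ⟨θ, hθ, hd⟩ := ht ⟨htmem.1, h.le⟩
      refine ⟨θ, hθ, ?_⟩
      rw [if_pos h.le]
      refine hd.congr_of_eventuallyEq ?_
      filter_upwards [Iio_mem_nhds h] with r hr
      exact if_pos (le_of_lt hr)
    · obtain ⟨θ, hθ, hd⟩ := ht' ⟨by linarith, by linarith [htmem.2]⟩
      refine ⟨θ, hθ, ?_⟩
      rw [if_neg h.not_ge]
      refine (hd.comp_sub_const t S).congr_of_eventuallyEq ?_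
      filter_upwards [Ioi_mem_nhds h] with r hr
      exact if_neg (not_le.2 hr)
  · simp [hS.le, h0]
  · simp [hT, h1']

lemma bddBelow_travelTimes : BddBelow (travelTimes X x y) := ⟨0, fun _ h => h.1.le⟩

lemma ccDist_comm : ccDist X x y = ccDist X y x := by
  unfold ccDist
  congr 1
  ext T
  exact ⟨travelTimes_symm, travelTimes_symm⟩

lemma ccDist_triangle (hX : ∀ x y, (travelTimes X x y).Nonempty) :
    ccDist X x z ≤ ccDist X x y + ccDist X y z := by
  refine le_of_forall_pos_lt_add fun ε hε => ?_
  obtain ⟨S, hS, hS'⟩ := Real.lt_sInf_add_pos (hX x y) (half_pos hε)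
  obtain ⟨T, hT, hT'⟩ := Real.lt_sInf_add_pos (hX y z) (half_pos hε)
  have := csInf_le bddBelow_travelTimes (travelTimes_add hS hT)
  unfold ccDist
  linarith

variable {Q : ℝ}

lemma GeometricAssumptions.ccDist_self (hX : GeometricAssumptions X Q)
    (x : EuclideanSpace ℝ (Fin N)) : ccDist X x x = 0 :=
  tendsto_nhds_unique tendsto_const_nhds ((hX.topology x fun _ => x).1 tendsto_const_nhds)

/-- The control distance as a pseudometric, before its topology is identified. -/
abbrev GeometricAssumptions.ccPseudoMetricSpaceAux (hX : GeometricAssumptions X Q) :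
    PseudoMetricSpace (EuclideanSpace ℝ (Fin N)) where
  dist := ccDist X
  dist_self := hX.ccDist_self
  dist_comm _ _ := ccDist_comm
  dist_triangle _ _ _ := ccDist_triangle hX.connected

/-- Both neighbourhood filters are countably generated, so they are determined by their convergent
sequences, on which the hypothesis `topology` makes them agree. -/
lemma GeometricAssumptions.nhds_eq (hX : GeometricAssumptions X Q)
    (x : EuclideanSpace ℝ (Fin N)) :
    𝓝 x = @nhds _ hX.ccPseudoMetricSpaceAux.toUniformSpace.toTopologicalSpace x := by
  have hcg : (@nhds _ hX.ccPseudoMetricSpaceAux.toUniformSpace.toTopologicalSpace x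
    ).IsCountablyGenerated :=
    @PseudoMetricSpace.nhds_isCountablyGenerated _ hX.ccPseudoMetricSpaceAux x
  have key : ∀ y : ℕ → EuclideanSpace ℝ (Fin N), Tendsto y atTop (𝓝 x) ↔
      Tendsto y atTop
        (@nhds _ hX.ccPseudoMetricSpaceAux.toUniformSpace.toTopologicalSpace x) := by
    intro y
    rw [hX.topology x y, @tendsto_iff_dist_tendsto_zero _ _ hX.ccPseudoMetricSpaceAux]
    simp_rw [@dist_comm _ hX.ccPseudoMetricSpaceAux _ x]
    rfl
  apply le_antisymm
  · exact tendsto_id'.1 (tendsto_of_seq_tendsto fun y hy => (key y).1 hy)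
  · exact tendsto_id'.1 (tendsto_of_seq_tendsto fun y hy => (key y).2 hy)

/-- The control distance as a pseudometric inducing the Euclidean topology. -/
abbrev GeometricAssumptions.ccPseudoMetricSpace (hX : GeometricAssumptions X Q) :
    PseudoMetricSpace (EuclideanSpace ℝ (Fin N)) :=
  -- The topology becomes definitionally the Euclidean one, so Borel and separability instances
  -- carry over.
  hX.ccPseudoMetricSpaceAux.replaceTopology (TopologicalSpace.ext_nhds hX.nhds_eq)

lemma GeometricAssumptions.ball_eq (hX : GeometricAssumptions X Q)
    (x : EuclideanSpace ℝ (Fin N)) (r : ℝ) :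
    @Metric.ball _ hX.ccPseudoMetricSpace x r = ccBall X x r := by
  ext y
  change ccDist X y x < r ↔ ccDist X x y < r
  rw [ccDist_comm]

end ControlDistance

end

/-! ### The maximal function on a doubling space -/

noncomputable section

lemma setLAverage_le_of_le {α : Type*} [MeasurableSpace α] {μ : Measure α}
    {g : α → ℝ≥0∞} {C : ℝ≥0∞} (s : Set α) (hg : ∀ x, g x ≤ C) :
    ⨍⁻ y in s, g y ∂μ ≤ C := by
  rw [setLAverage_eq]
  refine ENNReal.div_le_of_le_mul ?_
  calc ∫⁻ y in s, g y ∂μ ≤ ∫⁻ _ in s, C ∂μ := lintegral_mono hg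
    _ = C * μ s := by simp

section Maximal

variable {α : Type*} [PseudoMetricSpace α] [MeasurableSpace α] {μ : Measure α} {Q R : ℝ}

/-- A measure with positive finite measure of balls, doubling with exponent `Q`. -/
structure IsDoublingWith (μ : Measure α) (Q : ℝ) : Prop where
  pos : ∀ x r, 0 < r → 0 < μ (Metric.ball x r)
  lt_top : ∀ x r, μ (Metric.ball x r) < ⊤
  le : ∀ x r, 0 < r → μ (Metric.ball x (2 * r)) ≤ ENNReal.ofReal (2 ^ Q) * μ (Metric.ball x r)

lemma IsDoublingWith.two_pow_le (hμ : IsDoublingWith μ Q) (x : α) {r : ℝ} (hr : 0 < r) (n : ℕ) :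
    μ (Metric.ball x (2 ^ n * r)) ≤ ENNReal.ofReal (2 ^ Q) ^ n * μ (Metric.ball x r) := by
  induction n with
  | zero => simp
  | succ n ih =>
    calc μ (Metric.ball x (2 ^ (n + 1) * r)) = μ (Metric.ball x (2 * (2 ^ n * r))) := by
          ring_nf
      _ ≤ ENNReal.ofReal (2 ^ Q) * μ (Metric.ball x (2 ^ n * r)) := hμ.le _ _ (by positivity)
      _ ≤ ENNReal.ofReal (2 ^ Q) * (ENNReal.ofReal (2 ^ Q) ^ n * μ (Metric.ball x r)) := by gcongr
      _ = _ := by ring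

/-- The uncentred maximal function over balls of radius at most `R`. -/
def maximalFunction (μ : Measure α) (R : ℝ) (g : α → ℝ≥0∞) (x : α) : ℝ≥0∞ :=
  ⨆ (b : α × ℝ) (_ : b.2 ≤ R ∧ x ∈ Metric.ball b.1 b.2), ⨍⁻ y in Metric.ball b.1 b.2, g y ∂μ

lemma laverage_le_maximalFunction {g : α → ℝ≥0∞} {c x : α} {r : ℝ} (hr : r ≤ R)
    (hx : x ∈ Metric.ball c r) : ⨍⁻ y in Metric.ball c r, g y ∂μ ≤ maximalFunction μ R g x :=
  le_iSup₂_of_le (f := fun (b : α × ℝ) (_ : b.2 ≤ R ∧ x ∈ Metric.ball b.1 b.2) =>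
    ⨍⁻ y in Metric.ball b.1 b.2, g y ∂μ) (c, r) ⟨hr, hx⟩ le_rfl

/-- Because the maximal function is uncentred, its superlevel sets are unions of open balls. This
yields measurability for arbitrary `g`, and the balls form the family to which Vitali's lemma is
applied. -/
lemma setOf_lt_maximalFunction (g : α → ℝ≥0∞) (t : ℝ≥0∞) :
    {x | t < maximalFunction μ R g x} =
      ⋃ b ∈ {b : α × ℝ | b.2 ≤ R ∧ t < ⨍⁻ y in Metric.ball b.1 b.2, g y ∂μ},
        Metric.ball b.1 b.2 := by
  ext x
  simp only [maximalFunction, mem_ofPred_eq, lt_iSup_iff, mem_iUnion, exists_prop]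
  exact ⟨fun ⟨b, h, h'⟩ => ⟨b, ⟨h.1, h'⟩, h.2⟩, fun ⟨b, h, h'⟩ => ⟨b, ⟨h.1, h'⟩, h.2⟩⟩

lemma measurable_maximalFunction [OpensMeasurableSpace α] (g : α → ℝ≥0∞) :
    Measurable (maximalFunction μ R g) := by
  refine measurable_of_Ioi fun t => ?_
  change MeasurableSet {x | t < maximalFunction μ R g x}
  rw [setOf_lt_maximalFunction]
  exact (isOpen_biUnion fun _ _ => Metric.isOpen_ball).measurableSet

lemma maximalFunction_le_of_le {g : α → ℝ≥0∞} {C : ℝ≥0∞} (hg : ∀ x, g x ≤ C) (x : α) :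
    maximalFunction μ R g x ≤ C :=
  iSup₂_le fun _ _ => setLAverage_le_of_le _ hg

/-- Used to cut a function at a given height: the part below that height raises the maximal function
by at most the height. -/
lemma maximalFunction_le_add_const {g g' : α → ℝ≥0∞} {C : ℝ≥0∞} (h : ∀ x, g x ≤ g' x + C) (x : α) :
    maximalFunction μ R g x ≤ maximalFunction μ R g' x + C := by
  refine iSup₂_le fun b hb => ?_
  calc ⨍⁻ y in Metric.ball b.1 b.2, g y ∂μ
      ≤ ⨍⁻ y in Metric.ball b.1 b.2, (g' y + C) ∂μ := lintegral_mono h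
    _ = ⨍⁻ y in Metric.ball b.1 b.2, g' y ∂μ + ⨍⁻ y in Metric.ball b.1 b.2, C ∂μ :=
        lintegral_add_right _ measurable_const
    _ ≤ _ := by
        gcongr
        · exact laverage_le_maximalFunction hb.1 hb.2
        · exact setLAverage_le_of_le _ fun _ => le_rfl

/-- The weak `(1,1)` inequality for the maximal function. -/
theorem IsDoublingWith.weak_type_maximalFunction [OpensMeasurableSpace α]
    [TopologicalSpace.SeparableSpace α] (hμ : IsDoublingWith μ Q) (g : α → ℝ≥0∞) (t : ℝ≥0∞) :
    t * μ {x | t < maximalFunction μ R g x} ≤ ENNReal.ofReal (2 ^ Q) ^ 3 * ∫⁻ x, g x ∂μ := by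
  rw [setOf_lt_maximalFunction]
  set F : Set (α × ℝ) := {b | b.2 ≤ R ∧ t < ⨍⁻ y in Metric.ball b.1 b.2, g y ∂μ} with hF
  set K := ENNReal.ofReal (2 ^ Q)
  -- Balls of nonpositive radius are empty and their average is 0, which cannot exceed `t`.
  have hpos : ∀ b ∈ F, 0 < b.2 := by
    intro b hb
    by_contra! h
    have := hb.2
    rw [Metric.ball_eq_empty.2 h] at this
    simp at this
  have havg : ∀ b ∈ F, t * μ (Metric.ball b.1 b.2) ≤ ∫⁻ y in Metric.ball b.1 b.2, g y ∂μ := by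
    intro b hb
    have := hb.2.le
    rw [setLAverage_eq] at this
    exact (ENNReal.le_div_iff_mul_le (Or.inl (hμ.pos _ _ (hpos b hb)).ne')
      (Or.inl (hμ.lt_top _ _).ne)).1 this
  obtain ⟨u, huF, hdisj, hcov⟩ := Vitali.exists_disjoint_subfamily_covering_enlargement
    (fun b : α × ℝ => Metric.ball b.1 b.2) F (fun b => b.2) 2 one_lt_two
    (fun b hb => (hpos b hb).le) R (fun b hb => hb.1)
    (fun b hb => Metric.nonempty_ball.2 (hpos b hb))
  have hcount : u.Countable := hdisj.countable_of_isOpen (fun _ _ => Metric.isOpen_ball)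
    (fun b hb => Metric.nonempty_ball.2 (hpos b (huF hb)))
  -- A ball meeting `b` with radius at most `2 * b.2` lies in the ball of radius `5 * b.2`; rounding
  -- 5 up to `2 ^ 3` costs three doublings.
  have hsub : (⋃ b ∈ F, Metric.ball b.1 b.2) ⊆ ⋃ b ∈ u, Metric.ball b.1 (2 ^ 3 * b.2) := by
    refine iUnion₂_subset fun a ha => ?_
    obtain ⟨b, hb, ⟨z, hza, hzb⟩, hab⟩ := hcov a ha
    refine fun x hx => mem_iUnion₂.2 ⟨b, hb, ?_⟩
    rw [Metric.mem_ball] at hx hza hzb ⊢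
    have h1 := dist_triangle x a.1 b.1
    have h2 := dist_triangle a.1 z b.1
    rw [dist_comm a.1 z] at h2
    have := hpos b (huF hb)
    linarith
  have : Countable u := hcount
  calc t * μ (⋃ b ∈ F, Metric.ball b.1 b.2)
      ≤ t * ∑' b : u, μ (Metric.ball b.1.1 (2 ^ 3 * b.1.2)) := by
        gcongr
        exact (measure_mono hsub).trans (measure_biUnion_le _ hcount _)
    _ ≤ t * ∑' b : u, K ^ 3 * μ (Metric.ball b.1.1 b.1.2) := by
        gcongr with b
        exact hμ.two_pow_le _ (hpos _ (huF b.2)) 3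
    _ = K ^ 3 * ∑' b : u, t * μ (Metric.ball b.1.1 b.1.2) := by
        rw [ENNReal.tsum_mul_left, ENNReal.tsum_mul_left]
        ring
    _ ≤ K ^ 3 * ∑' b : u, ∫⁻ y in Metric.ball b.1.1 b.1.2, g y ∂μ := by
        gcongr with b
        exact havg _ (huF b.2)
    _ = K ^ 3 * ∫⁻ y in ⋃ b ∈ u, Metric.ball b.1 b.2, g y ∂μ := by
        rw [lintegral_biUnion hcount (fun _ _ => measurableSet_ball) hdisj]
    _ ≤ _ := by
        gcongr
        exact Measure.restrict_le_self

lemma lintegral_Ioo_rpow {q c : ℝ} (hq : -1 < q) (hc : 0 ≤ c) :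
    ∫⁻ t in Ioo 0 c, ENNReal.ofReal (t ^ q) = ENNReal.ofReal (c ^ (q + 1) / (q + 1)) := by
  have hint : IntegrableOn (fun t : ℝ => t ^ q) (Ioc 0 c) :=
    (intervalIntegrable_iff_integrableOn_Ioc_of_le hc).1
      (intervalIntegral.intervalIntegrable_rpow' hq)
  rw [← ofReal_integral_eq_lintegral_ofReal (hint.mono_set Ioo_subset_Ioc_self)]
  · rw [← integral_Ioc_eq_integral_Ioo, ← intervalIntegral.integral_of_le hc,
      integral_rpow (Or.inl hq), Real.zero_rpow (by linarith), sub_zero]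
  · filter_upwards [ae_restrict_mem measurableSet_Ioo] with t ht
    exact Real.rpow_nonneg ht.1.le _

/-- The strong `(p,p)` inequality for the maximal function of a bounded function. -/
theorem IsDoublingWith.strong_type_maximalFunction [OpensMeasurableSpace α]
    [TopologicalSpace.SeparableSpace α] [SFinite μ] (hμ : IsDoublingWith μ Q) {p : ℝ} (hp : 1 < p)
    {f : α → ℝ} (hf : Measurable f) (hf0 : ∀ x, 0 ≤ f x) {B : ℝ} (hfB : ∀ x, f x ≤ B) :
    ∫⁻ x, maximalFunction μ R (fun y => ENNReal.ofReal (f y)) x ^ p ∂μ ≤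
      ENNReal.ofReal ((2 ^ Q) ^ 3 * p * 2 ^ p / (p - 1)) * ∫⁻ x, ENNReal.ofReal (f x) ^ p ∂μ := by
  set g : α → ℝ≥0∞ := fun y => ENNReal.ofReal (f y) with hg
  set M := maximalFunction μ R g with hM
  -- Boundedness of `f` is used only here, to allow the layer-cake formula for real-valued
  -- functions; `B` does not enter the constant.
  have hMtop : ∀ x, M x ≠ ⊤ := fun x => ne_top_of_le_ne_top ENNReal.ofReal_ne_top
    (maximalFunction_le_of_le (fun y => ENNReal.ofReal_le_ofReal (hfB y)) x)
  have hMm : Measurable M := measurable_maximalFunction g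
  -- Values of `f` up to `t / 2` contribute at most `t / 2`, so where `M > t` the maximal function
  -- of the remaining part exceeds `t / 2`. The weak inequality applies to that part.
  have hlevel : ∀ t : ℝ, 0 < t → ENNReal.ofReal (t / 2) * μ {x | t < (M x).toReal} ≤
      ENNReal.ofReal (2 ^ Q) ^ 3 * ∫⁻ x, {x | t / 2 < f x}.indicator g x ∂μ := by
    intro t ht
    refine le_trans ?_ (hμ.weak_type_maximalFunction (R := R)
      ({x | t / 2 < f x}.indicator g) (ENNReal.ofReal (t / 2)))
    gcongr _ * μ ?_
    intro x hx
    have h1 : M x ≤ maximalFunction μ R ({x | t / 2 < f x}.indicator g) x +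
        ENNReal.ofReal (t / 2) := by
      refine maximalFunction_le_add_const (fun y => ?_) x
      by_cases hy : t / 2 < f y
      · rw [indicator_of_mem (by exact hy)]
        exact le_self_add
      · rw [indicator_of_notMem (by exact hy), zero_add]
        exact ENNReal.ofReal_le_ofReal (not_lt.1 hy)
    have h2 : ENNReal.ofReal t < M x := (ENNReal.ofReal_lt_iff_lt_toReal ht.le (hMtop x)).2 hx
    by_contra! hcon
    rw [mem_ofPred_eq, not_lt] at hcon
    have h3 := h1.trans (add_le_add_left hcon _)
    rw [← ENNReal.ofReal_add (by positivity) (by positivity), add_halves] at h3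
    exact absurd h2 (not_lt.2 h3)
  have hlevel' : ∀ t : ℝ, 0 < t → μ {x | t < (M x).toReal} * ENNReal.ofReal (t ^ (p - 1)) ≤
      ENNReal.ofReal (2 ^ Q) ^ 3 * 2 *
        ∫⁻ x, {x | t / 2 < f x}.indicator g x * ENNReal.ofReal (t ^ (p - 2)) ∂μ := by
    intro t ht
    rw [lintegral_mul_const _ (hf.ennreal_ofReal.indicator
      (measurableSet_lt measurable_const hf))]
    have e : ENNReal.ofReal (t ^ (p - 1)) =
        ENNReal.ofReal (t / 2) * 2 * ENNReal.ofReal (t ^ (p - 2)) := by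
      rw [← ENNReal.ofReal_ofNat 2, ← ENNReal.ofReal_mul (by positivity),
        ← ENNReal.ofReal_mul (by positivity), div_mul_cancel₀ _ two_ne_zero,
        show p - 1 = 1 + (p - 2) by ring, Real.rpow_add ht, Real.rpow_one]
    rw [e]
    calc _ = (ENNReal.ofReal (t / 2) * μ {x | t < (M x).toReal}) *
          (2 * ENNReal.ofReal (t ^ (p - 2))) := by ring
      _ ≤ (ENNReal.ofReal (2 ^ Q) ^ 3 * ∫⁻ x, {x | t / 2 < f x}.indicator g x ∂μ) *
          (2 * ENNReal.ofReal (t ^ (p - 2))) := by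
          gcongr ?_ * _
          exact hlevel t ht
      _ = _ := by ring
  -- The integrand lives on 0 < t < 2 f(x), and t^(p-2) is integrable at 0 because p > 1.
  have hinner : ∀ x, ∫⁻ t in Ioi (0 : ℝ), {x | t / 2 < f x}.indicator g x *
      ENNReal.ofReal (t ^ (p - 2)) = ENNReal.ofReal (2 ^ (p - 1) / (p - 1)) * g x ^ p := by
    intro x
    have e : ∀ t ∈ Ioi (0 : ℝ), {x | t / 2 < f x}.indicator g x * ENNReal.ofReal (t ^ (p - 2)) =
        (Ioo 0 (2 * f x)).indicator (fun t => g x * ENNReal.ofReal (t ^ (p - 2))) t := by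
      intro t ht
      have ht : 0 < t := ht
      by_cases h : t / 2 < f x
      · rw [indicator_of_mem (by exact h), indicator_of_mem]
        exact ⟨ht, by linarith⟩
      · rw [indicator_of_notMem (by exact h), indicator_of_notMem, zero_mul]
        rintro ⟨-, h'⟩
        exact h (by linarith)
    rw [setLIntegral_congr_fun measurableSet_Ioi e, lintegral_indicator measurableSet_Ioo,
      Measure.restrict_restrict measurableSet_Ioo,
      inter_eq_left.2 (show Ioo 0 (2 * f x) ⊆ Ioi 0 from fun t ht => ht.1),
      lintegral_const_mul' _ _ ENNReal.ofReal_ne_top,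
      lintegral_Ioo_rpow (by linarith) (mul_nonneg two_pos.le (hf0 x)), hg]
    have hp1 : 0 < p - 1 := by linarith
    rw [ENNReal.ofReal_rpow_of_nonneg (hf0 x) (by linarith), ← ENNReal.ofReal_mul (hf0 x),
      ← ENNReal.ofReal_mul (by positivity)]
    congr 1
    rw [show p - 2 + 1 = p - 1 by ring, Real.mul_rpow two_pos.le (hf0 x)]
    have : f x ^ p = f x * f x ^ (p - 1) := by
      rw [mul_comm, Real.rpow_sub_one' (hf0 x) (by linarith)]
      rcases (hf0 x).eq_or_lt with h | h
      · rw [← h, Real.zero_rpow (by linarith)]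
        simp
      · field_simp
    rw [this]
    ring
  calc ∫⁻ x, M x ^ p ∂μ = ∫⁻ x, ENNReal.ofReal ((M x).toReal ^ p) ∂μ := by
        refine lintegral_congr fun x => ?_
        rw [← ENNReal.ofReal_rpow_of_nonneg ENNReal.toReal_nonneg (by linarith),
          ENNReal.ofReal_toReal (hMtop x)]
    _ = ENNReal.ofReal p * ∫⁻ t in Ioi (0 : ℝ), μ {x | t < (M x).toReal} *
          ENNReal.ofReal (t ^ (p - 1)) :=
        lintegral_rpow_eq_lintegral_meas_lt_mul μ
          (Eventually.of_forall fun _ => ENNReal.toReal_nonneg)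
          hMm.ennreal_toReal.aemeasurable (by linarith)
    _ ≤ ENNReal.ofReal p * ∫⁻ t in Ioi (0 : ℝ), ENNReal.ofReal (2 ^ Q) ^ 3 * 2 *
          ∫⁻ x, {x | t / 2 < f x}.indicator g x * ENNReal.ofReal (t ^ (p - 2)) ∂μ := by
        gcongr ENNReal.ofReal p * ?_
        exact setLIntegral_mono' measurableSet_Ioi hlevel'
    _ = ENNReal.ofReal p * (ENNReal.ofReal (2 ^ Q) ^ 3 * 2 * ∫⁻ x, (∫⁻ t in Ioi (0 : ℝ),
          {x | t / 2 < f x}.indicator g x * ENNReal.ofReal (t ^ (p - 2))) ∂μ) := by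
        rw [lintegral_const_mul' _ _ (by finiteness), lintegral_lintegral_swap]
        refine Measurable.aemeasurable ?_
        refine Measurable.mul ?_ (by fun_prop)
        have : (fun q : ℝ × α => {x | q.1 / 2 < f x}.indicator g q.2) =
            {q : ℝ × α | q.1 / 2 < f q.2}.indicator (fun q => g q.2) := by
          ext q
          simp [indicator]
        rw [this]
        exact (hf.ennreal_ofReal.comp measurable_snd).indicator
          (measurableSet_lt (by fun_prop) (by fun_prop))
    _ = _ := by
        simp_rw [hinner]
        rw [lintegral_const_mul' _ _ ENNReal.ofReal_ne_top, ← mul_assoc, ← mul_assoc]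
        congr 1
        have hp1 : 0 < p - 1 := by linarith
        rw [← ENNReal.ofReal_ofNat 2, ← ENNReal.ofReal_pow (by positivity),
          ← ENNReal.ofReal_mul (by positivity), ← ENNReal.ofReal_mul (by positivity),
          ← ENNReal.ofReal_mul (by positivity)]
        congr 1
        rw [Real.rpow_sub_one two_ne_zero]
        field_simp

end Maximal

end

/-! ### Hedberg's argument and the Sobolev inequality on a doubling space -/

noncomputable section

/-- A geometric sum cut at the scale where the two competing powers balance. -/
lemma exists_tsum_min_rpow_le {q : ℝ} (hq : 1 < q) : ∃ C : ℝ≥0∞, C ≠ ⊤ ∧ 1 ≤ C ∧ ∀ ρ : ℝ, 0 < ρ →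
    ∑' i : ℕ, ENNReal.ofReal (min ((1 / 2) ^ i * ρ) (((1 / 2) ^ i * ρ) ^ (1 - q))) ≤ C := by
  set θ : ℝ := 2 ^ (1 - q) with hθ
  have hθ0 : 0 < θ := by positivity
  have hθ1 : θ < 1 := Real.rpow_lt_one_of_one_lt_of_neg one_lt_two (by linarith)
  have hgeo : ∑' i : ℕ, ENNReal.ofReal θ ^ i ≠ ⊤ := by
    rw [ENNReal.tsum_geometric]
    refine ENNReal.inv_ne_top.2 ?_
    rw [← ENNReal.ofReal_one, ← ENNReal.ofReal_sub _ hθ0.le]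
    simpa using hθ1
  have hgeo2 : ∑' i : ℕ, ENNReal.ofReal (1 / 2) ^ i ≠ ⊤ := by
    rw [ENNReal.tsum_geometric]
    refine ENNReal.inv_ne_top.2 ?_
    rw [← ENNReal.ofReal_one, ← ENNReal.ofReal_sub _ (by norm_num)]
    norm_num
  refine ⟨∑' i : ℕ, ENNReal.ofReal θ ^ i + ∑' i : ℕ, ENNReal.ofReal (1 / 2) ^ i,
    by finiteness, ?_, fun ρ hρ => ?_⟩
  · refine le_trans ?_ le_self_add
    exact (pow_zero _).symm.trans_le (ENNReal.le_tsum (f := fun i : ℕ => ENNReal.ofReal θ ^ i) 0)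
  have hex : ∃ n : ℕ, (1 / 2 : ℝ) ^ n * ρ ≤ 1 := by
    obtain ⟨n, hn⟩ := exists_pow_lt_of_lt_one (inv_pos.2 hρ) (show (1 / 2 : ℝ) < 1 by norm_num)
    refine ⟨n, ?_⟩
    calc (1 / 2 : ℝ) ^ n * ρ ≤ ρ⁻¹ * ρ := by gcongr
      _ = 1 := inv_mul_cancel₀ hρ.ne'
  classical
  -- `n` is the first index whose scale is at most 1. Before it the power `1 - q` gives a geometric
  -- progression read backwards; from it on the linear term is geometric.
  set n := Nat.find hex
  have hn : (1 / 2 : ℝ) ^ n * ρ ≤ 1 := Nat.find_spec hex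
  rw [← ENNReal.summable.sum_add_tsum_nat_add' (k := n)]
  gcongr ?_ + ?_
  · have h1 : ∀ i ∈ Finset.range n,
        ENNReal.ofReal (min ((1 / 2) ^ i * ρ) (((1 / 2) ^ i * ρ) ^ (1 - q))) ≤
          ENNReal.ofReal θ ^ (n - 1 - i) := by
      intro i hi
      have hi : i < n := Finset.mem_range.1 hi
      have hlt : 1 < (1 / 2 : ℝ) ^ (n - 1) * ρ :=
        not_le.1 (Nat.find_min hex (show n - 1 < n by omega))
      rw [← ENNReal.ofReal_pow hθ0.le]
      refine ENNReal.ofReal_le_ofReal ((min_le_right _ _).trans ?_)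
      have h2 : (2 : ℝ) ^ (n - 1 - i) ≤ (1 / 2) ^ i * ρ := by
        have e : (1 / 2 : ℝ) ^ (n - 1) = (1 / 2) ^ (n - 1 - i) * (1 / 2) ^ i := by
          rw [← pow_add]
          congr 1
          omega
        rw [e, one_div, inv_pow] at hlt
        have h3 : (0 : ℝ) < 2 ^ (n - 1 - i) := by positivity
        rw [one_div]
        rw [mul_assoc, inv_mul_eq_div, lt_div_iff₀ h3] at hlt
        linarith
      calc ((1 / 2) ^ i * ρ) ^ (1 - q) ≤ ((2 : ℝ) ^ (n - 1 - i)) ^ (1 - q) :=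
            Real.rpow_le_rpow_of_nonpos (by positivity) h2 (by linarith)
        _ = θ ^ (n - 1 - i) := by
            rw [hθ, ← Real.rpow_natCast, ← Real.rpow_natCast, ← Real.rpow_mul two_pos.le,
              ← Real.rpow_mul two_pos.le, mul_comm]
    refine (Finset.sum_le_sum h1).trans ?_
    rw [Finset.sum_range_reflect (fun j => ENNReal.ofReal θ ^ j) n]
    exact ENNReal.sum_le_tsum _
  · refine ENNReal.tsum_le_tsum fun i => ?_
    rw [← ENNReal.ofReal_pow (by norm_num)]
    refine ENNReal.ofReal_le_ofReal ((min_le_left _ _).trans ?_)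
    rw [pow_add, mul_assoc]
    exact mul_le_of_le_one_right (by positivity) hn

/-- Hedberg's optimisation for dyadic sums. -/
lemma exists_tsum_mul_min_le {q : ℝ} (hq : 1 < q) : ∃ C : ℝ≥0∞, C ≠ ⊤ ∧
    ∀ (M K : ℝ≥0∞) (R : ℝ), 0 < R →
      ∑' i : ℕ, ENNReal.ofReal ((1 / 2) ^ i * R) *
        min M (K * ENNReal.ofReal (((1 / 2) ^ i * R) ^ (-q))) ≤
          C * (M ^ (1 - 1 / q) * K ^ (1 / q)) := by
  obtain ⟨C, hC, hC1, H⟩ := exists_tsum_min_rpow_le hq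
  -- Needed so that `C * ⊤ = ⊤` in the degenerate cases below.
  have hC0 : C ≠ 0 := (zero_lt_one.trans_le hC1).ne'
  have hq0 : 0 < 1 / q := by positivity
  have hq1 : 0 < 1 - 1 / q := by
    rw [sub_pos, div_lt_one (by linarith)]
    exact hq
  refine ⟨C, hC, fun M K R hR => ?_⟩
  rcases eq_or_ne M 0 with rfl | hM0
  · simp
  rcases eq_or_ne K 0 with rfl | hK0
  · simp
  rcases eq_or_ne M ⊤ with rfl | hM
  · rw [ENNReal.top_rpow_of_pos hq1, ENNReal.top_mul, ENNReal.mul_top hC0]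
    · exact le_top
    · simp only [Ne, ENNReal.rpow_eq_zero_iff, hK0, false_and, false_or, not_and, not_lt]
      exact fun _ => hq0.le
  rcases eq_or_ne K ⊤ with rfl | hK
  · rw [ENNReal.top_rpow_of_pos hq0, ENNReal.mul_top, ENNReal.mul_top hC0]
    · exact le_top
    · simp [ENNReal.rpow_eq_zero_iff, hM0, hM]
  obtain ⟨m, hm, rfl⟩ : ∃ m : ℝ, 0 < m ∧ ENNReal.ofReal m = M :=
    ⟨M.toReal, ENNReal.toReal_pos hM0 hM, ENNReal.ofReal_toReal hM⟩
  obtain ⟨k, hk, rfl⟩ : ∃ m : ℝ, 0 < m ∧ ENNReal.ofReal m = K :=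
    ⟨K.toReal, ENNReal.toReal_pos hK0 hK, ENNReal.ofReal_toReal hK⟩
  -- The radius where both bounds agree, k r₀^(-q) = m. In units of `r₀` every term is r₀ m · min(ρ,
  -- ρ^(1-q)), and r₀ m is the required product of powers.
  set r₀ : ℝ := (k / m) ^ (1 / q) with hr₀
  have hr₀0 : 0 < r₀ := by positivity
  have hbal : k * r₀ ^ (-q) = m := by
    rw [hr₀, ← Real.rpow_mul (by positivity), show 1 / q * -q = -1 by field_simp,
      Real.rpow_neg_one]
    field_simp
  have hprod : r₀ * m = m ^ (1 - 1 / q) * k ^ (1 / q) := by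
    rw [hr₀, Real.div_rpow hk.le hm.le, Real.rpow_sub hm, Real.rpow_one]
    ring
  have hterm : ∀ i : ℕ, ENNReal.ofReal ((1 / 2) ^ i * R) * min (ENNReal.ofReal m)
      (ENNReal.ofReal k * ENNReal.ofReal (((1 / 2) ^ i * R) ^ (-q))) =
        ENNReal.ofReal (r₀ * m) * ENNReal.ofReal (min ((1 / 2) ^ i * (R / r₀))
          (((1 / 2) ^ i * (R / r₀)) ^ (1 - q))) := by
    intro i
    set r : ℝ := (1 / 2) ^ i * R with hr
    have hr0 : 0 < r := by positivity
    have e : (1 / 2) ^ i * (R / r₀) = r / r₀ := by rw [hr]; ring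
    have hmono : Monotone ENNReal.ofReal := ENNReal.ofReal_mono
    rw [e, ← ENNReal.ofReal_mul hk.le, ← hmono.map_min, ← ENNReal.ofReal_mul hr0.le,
      ← ENNReal.ofReal_mul (by positivity), mul_min_of_nonneg _ _ hr0.le,
      mul_min_of_nonneg _ _ (by positivity)]
    congr 2
    · field_simp
    · rw [Real.div_rpow hr0.le hr₀0.le, Real.rpow_sub hr0, Real.rpow_sub hr₀0, Real.rpow_one,
        Real.rpow_one, ← hbal, Real.rpow_neg hr₀0.le, Real.rpow_neg hr0.le]
      have := Real.rpow_pos_of_pos hr0 q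
      have := Real.rpow_pos_of_pos hr₀0 q
      field_simp
  simp_rw [hterm]
  rw [ENNReal.tsum_mul_left, hprod, mul_comm, ENNReal.ofReal_mul (by positivity),
    ← ENNReal.ofReal_rpow_of_pos hm, ← ENNReal.ofReal_rpow_of_pos hk]
  gcongr
  exact H _ (by positivity)

section Averages

variable {α : Type*} [MeasurableSpace α] {μ : Measure α}

lemma enorm_average_sub_le {u : α → ℝ} {s : Set α} (hu : IntegrableOn u s μ) (h0 : μ s ≠ 0)
    (h1 : μ s ≠ ⊤) (c : ℝ) : ‖⨍ y in s, u y ∂μ - c‖ₑ ≤ ⨍⁻ y in s, ‖u y - c‖ₑ ∂μ := by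
  have : NeZero (μ.restrict s) := ⟨by simpa using h0⟩
  have : IsFiniteMeasure (μ.restrict s) := ⟨by simpa using h1.lt_top⟩
  have e : ⨍ y in s, u y ∂μ - c = ⨍ y in s, (u y - c) ∂μ := by
    have hc := average_const (μ.restrict s) c
    rw [average] at hc
    rw [average, average, integral_sub hu.to_average (integrable_const _), hc]
  rw [e]
  exact enorm_integral_le_lintegral_enorm _

lemma setLAverage_le_mul_setLAverage {g : α → ℝ≥0∞} {s t : Set α} {K : ℝ≥0∞} (hst : s ⊆ t)
    (h0 : μ s ≠ 0) (h1 : μ t ≠ ⊤) (hK : μ t ≤ K * μ s) :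
    ⨍⁻ y in s, g y ∂μ ≤ K * ⨍⁻ y in t, g y ∂μ := by
  have ht0 : μ t ≠ 0 := fun h => h0 (measure_mono_null hst h)
  have hs1 : μ s ≠ ⊤ := ne_top_of_le_ne_top h1 (measure_mono hst)
  rw [setLAverage_eq, setLAverage_eq]
  refine ENNReal.div_le_of_le_mul ?_
  calc ∫⁻ y in s, g y ∂μ ≤ ∫⁻ y in t, g y ∂μ := lintegral_mono_set hst
    _ = (∫⁻ y in t, g y ∂μ) / μ t * μ t := (ENNReal.div_mul_cancel ht0 h1).symm
    _ ≤ (∫⁻ y in t, g y ∂μ) / μ t * (K * μ s) := by gcongr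
    _ = _ := by ring

/-- Hölder against the constant 1; dividing μ(s)^(1/p') by μ(s) leaves μ(s)^(-1/p). -/
lemma setLAverage_le_rpow {g : α → ℝ≥0∞} (hg : AEMeasurable g μ) {s : Set α} {p : ℝ} (hp : 1 < p)
    (h0 : μ s ≠ 0) (h1 : μ s ≠ ⊤) :
    ⨍⁻ y in s, g y ∂μ ≤ (∫⁻ y, g y ^ p ∂μ) ^ (1 / p) * μ s ^ (-(1 / p)) := by
  have hpq := Real.HolderConjugate.conjExponent hp
  have := ENNReal.lintegral_mul_le_Lp_mul_Lq (μ.restrict s) hpq hg.restrict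
    (aemeasurable_const (b := (1 : ℝ≥0∞)))
  simp only [Pi.mul_apply, mul_one, ENNReal.one_rpow, lintegral_const, one_mul,
    Measure.restrict_apply_univ] at this
  rw [setLAverage_eq]
  refine ENNReal.div_le_of_le_mul (this.trans ?_)
  have e : μ s ^ (-(1 / p)) * μ s = μ s ^ (1 / Real.conjExponent p) := by
    nth_rewrite 2 [← ENNReal.rpow_one (μ s)]
    rw [← ENNReal.rpow_add _ _ h0 h1]
    congr 1
    have := hpq.inv_add_inv_eq_one
    simp only [one_div]
    linarith
  rw [mul_assoc, e]
  gcongr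
  exact Measure.restrict_le_self

end Averages

section Sobolev

variable {α : Type*} [PseudoMetricSpace α] [MeasurableSpace α] {μ : Measure α} {Q : ℝ}

/-- The `(1,1)`-Poincaré inequality on all balls for the pair `(u, g)`. -/
def PoincarePair (μ : Measure α) (C_P ν : ℝ) (u : α → ℝ) (g : α → ℝ≥0∞) : Prop :=
  ∀ (x : α) (r : ℝ), 0 < r →
    ⨍⁻ y in Metric.ball x r, ‖u y - ⨍ z in Metric.ball x r, u z ∂μ‖ₑ ∂μ ≤
      ENNReal.ofReal (C_P * r) * ⨍⁻ y in Metric.ball x (ν * r), g y ∂μ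

/-- At a continuity point no differentiation theorem is needed; this suffices because Sobolev's
inequality is first proved for test functions. -/
lemma IsDoublingWith.tendsto_average [OpensMeasurableSpace α] (hμ : IsDoublingWith μ Q)
    {u : α → ℝ} (hint : ∀ x r, IntegrableOn u (Metric.ball x r) μ) {x : α} (hx : ContinuousAt u x)
    {r : ℕ → ℝ} (hr0 : ∀ i, 0 < r i) (hr : Tendsto r atTop (𝓝 0)) :
    Tendsto (fun i => ⨍ z in Metric.ball x (r i), u z ∂μ) atTop (𝓝 (u x)) := by
  rw [EMetric.tendsto_nhds]
  intro ε hε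
  obtain ⟨ε', hε'0, hε'⟩ := exists_between hε
  have h1 : ∀ᶠ y in 𝓝 x, ‖u y - u x‖ₑ ≤ ε' := by
    have := (EMetric.tendsto_nhds.1 hx) ε' hε'0
    filter_upwards [this] with y hy
    rw [← edist_eq_enorm_sub]
    exact hy.le
  obtain ⟨δ, hδ, hball⟩ := Metric.eventually_nhds_iff_ball.1 h1
  filter_upwards [hr.eventually (gt_mem_nhds hδ)] with i hi
  rw [edist_eq_enorm_sub]
  refine lt_of_le_of_lt ((enorm_average_sub_le (hint _ _) (hμ.pos _ _ (hr0 i)).ne'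
    (hμ.lt_top _ _).ne _).trans ?_) hε'
  rw [setLAverage_eq]
  refine ENNReal.div_le_of_le_mul ?_
  calc _ ≤ ∫⁻ _ in Metric.ball x (r i), ε' ∂μ :=
        setLIntegral_mono' measurableSet_ball fun y hy =>
          hball y (Metric.ball_subset_ball hi.le hy)
    _ = _ := by simp

/-- The telescoping estimate along the balls `B(x, 2^{-i} R)`. -/
lemma IsDoublingWith.enorm_le_tsum [OpensMeasurableSpace α] (hμ : IsDoublingWith μ Q)
    {Ω : Set α} (hΩ : MeasurableSet Ω) {u : α → ℝ} {g : α → ℝ≥0∞}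
    (hint : ∀ x r, IntegrableOn u (Metric.ball x r) μ)
    (hu0 : ∀ x ∉ Ω, u x = 0) {C_P ν : ℝ} (hP : PoincarePair μ C_P ν u g)
    {x : α} (hx : ContinuousAt u x) {R : ℝ} (hR : 0 < R) (hbig : 2 * μ Ω ≤ μ (Metric.ball x R)) :
    ‖u x‖ₑ ≤ (2 + ENNReal.ofReal (2 ^ Q)) * ∑' i : ℕ, ENNReal.ofReal (C_P * ((1 / 2) ^ i * R)) *
      ⨍⁻ y in Metric.ball x (ν * ((1 / 2) ^ i * R)), g y ∂μ := by
  set r : ℕ → ℝ := fun i => (1 / 2) ^ i * R with hr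
  have hr0 : ∀ i, 0 < r i := fun i => by positivity
  have hrlim : Tendsto r atTop (𝓝 0) := by
    simpa [hr] using (tendsto_pow_atTop_nhds_zero_of_lt_one (by norm_num)
      (show (1 / 2 : ℝ) < 1 by norm_num)).mul_const R
  set T : ℕ → ℝ≥0∞ := fun i => ENNReal.ofReal (C_P * r i) *
    ⨍⁻ y in Metric.ball x (ν * r i), g y ∂μ with hT
  set m : ℕ → ℝ := fun i => ⨍ z in Metric.ball x (r i), u z ∂μ with hm
  -- Consecutive means differ by at most the oscillation on the smaller ball; one doubling passes to
  -- the larger ball, where Poincaré applies.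
  have hstep : ∀ i, edist (m i) (m i.succ) ≤ ENNReal.ofReal (2 ^ Q) * T i := by
    intro i
    have hhalf : r i = 2 * r (i + 1) := by simp only [hr, pow_succ]; ring
    rw [edist_comm, edist_eq_enorm_sub]
    calc ‖m (i + 1) - m i‖ₑ ≤ ⨍⁻ y in Metric.ball x (r (i + 1)), ‖u y - m i‖ₑ ∂μ :=
          enorm_average_sub_le (hint _ _) (hμ.pos _ _ (hr0 _)).ne' (hμ.lt_top _ _).ne _
      _ ≤ ENNReal.ofReal (2 ^ Q) * ⨍⁻ y in Metric.ball x (r i), ‖u y - m i‖ₑ ∂μ := by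
          refine setLAverage_le_mul_setLAverage (Metric.ball_subset_ball ?_)
            (hμ.pos _ _ (hr0 _)).ne' (hμ.lt_top _ _).ne ?_
          · linarith [hr0 (i + 1)]
          · rw [hhalf]
            exact hμ.le _ _ (hr0 _)
      _ ≤ _ := by
          gcongr
          exact hP x (r i) (hr0 i)
  have hlim := edist_le_tsum_of_edist_le_of_tendsto₀ (f := m) _ hstep
    (hμ.tendsto_average hint hx hr0 hrlim)
  -- Since `u` vanishes on at least half of the largest ball, its mean there is itself dominated by
  -- the oscillation around that mean.
  have hfirst : ‖m 0‖ₑ ≤ 2 * T 0 := by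
    set B := Metric.ball x (r 0) with hB
    have hBR : B = Metric.ball x R := by simp [hB, hr]
    have hB0 : μ B ≠ 0 := (hμ.pos _ _ (hr0 _)).ne'
    have hB1 : μ B ≠ ⊤ := (hμ.lt_top _ _).ne
    have hΩ1 : μ Ω ≠ ⊤ := by
      refine fun h => hB1 (top_le_iff.1 ?_)
      rw [hBR]
      refine le_trans ?_ hbig
      rw [h]
      simp
    have hhalf : μ B ≤ 2 * μ (B \ Ω) := by
      have h1 : μ B ≤ μ (B \ Ω) + μ Ω := by
        rw [← measure_union_add_inter _ hΩ]
        exact (measure_mono (by simp)).trans le_self_add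
      have h2 : μ B + 2 * μ Ω ≤ 2 * μ (B \ Ω) + 2 * μ Ω := by
        calc μ B + 2 * μ Ω ≤ μ B + μ B := by gcongr; rwa [hBR]
          _ ≤ _ := by rw [← two_mul, ← mul_add]; gcongr
      exact (ENNReal.add_le_add_iff_right (by finiteness)).1 h2
    have hle : ‖m 0‖ₑ * μ B ≤ 2 * ∫⁻ y in B, ‖u y - m 0‖ₑ ∂μ := by
      calc ‖m 0‖ₑ * μ B ≤ ‖m 0‖ₑ * (2 * μ (B \ Ω)) := by gcongr
        _ = 2 * ∫⁻ y in B \ Ω, ‖m 0‖ₑ ∂μ := by simp; ring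
        _ = 2 * ∫⁻ y in B \ Ω, ‖u y - m 0‖ₑ ∂μ := by
            congr 1
            refine setLIntegral_congr_fun (measurableSet_ball.diff hΩ) fun y hy => ?_
            simp [hu0 y hy.2]
        _ ≤ _ := by gcongr; exact sdiff_subset
    calc ‖m 0‖ₑ ≤ (2 * ∫⁻ y in B, ‖u y - m 0‖ₑ ∂μ) / μ B :=
          (ENNReal.le_div_iff_mul_le (Or.inl hB0) (Or.inl hB1)).2 hle
      _ = 2 * ⨍⁻ y in B, ‖u y - m 0‖ₑ ∂μ := by rw [setLAverage_eq, mul_div_assoc]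
      _ ≤ _ := by gcongr; exact hP x (r 0) (hr0 0)
  calc ‖u x‖ₑ = edist (u x) 0 := (edist_zero_right _).symm
    _ ≤ edist (u x) (m 0) + edist (m 0) 0 := edist_triangle _ _ _
    _ ≤ ENNReal.ofReal (2 ^ Q) * ∑' i, T i + 2 * ∑' i, T i := by
        rw [edist_comm, edist_zero_right]
        refine add_le_add (hlim.trans_eq ENNReal.tsum_mul_left) (hfirst.trans ?_)
        gcongr
        exact ENNReal.le_tsum 0
    _ = _ := by ring

lemma exists_le_measure_ball_of_measure_univ_eq_top
    (huniv : μ univ = ⊤) (x₀ : α) (D : ℝ) {C : ℝ≥0∞} (hC : C ≠ ⊤) :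
    ∃ R : ℝ, 0 < R ∧ ∀ x ∈ Metric.ball x₀ D, C ≤ μ (Metric.ball x R) := by
  have hmono : Monotone fun n : ℕ => Metric.ball x₀ n := fun a b hab =>
    Metric.ball_subset_ball (by exact_mod_cast hab)
  have hlim := tendsto_measure_iUnion_atTop (μ := μ) hmono
  rw [Metric.iUnion_ball_nat, huniv] at hlim
  obtain ⟨n, hn⟩ := (hlim.eventually (lt_mem_nhds hC.lt_top)).exists
  refine ⟨n + |D| + 1, by positivity, fun x hx => hn.le.trans (measure_mono fun y hy => ?_)⟩
  simp only [Metric.mem_ball] at hx hy ⊢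
  have := dist_triangle y x₀ x
  rw [dist_comm x₀ x] at this
  linarith [le_abs_self D]

/-- A fixed number of doublings of B(x, R) covers B(x₀, R), uniformly for centres in a bounded set.
-/
lemma IsDoublingWith.exists_pos_le_measure_ball (hμ : IsDoublingWith μ Q) (x₀ : α) (D : ℝ)
    {R : ℝ} (hR : 0 < R) :
    ∃ c : ℝ≥0∞, c ≠ 0 ∧ ∀ x ∈ Metric.ball x₀ D, c ≤ μ (Metric.ball x R) := by
  obtain ⟨k, hk⟩ := pow_unbounded_of_one_lt ((R + D) / R) one_lt_two
  have h2 : ENNReal.ofReal (2 ^ Q) ^ k ≠ ⊤ := by finiteness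
  refine ⟨μ (Metric.ball x₀ R) / ENNReal.ofReal (2 ^ Q) ^ k,
    ENNReal.div_ne_zero.2 ⟨(hμ.pos _ _ hR).ne', h2⟩, fun x hx => ?_⟩
  refine ENNReal.div_le_of_le_mul ?_
  rw [mul_comm]
  refine le_trans (measure_mono fun y hy => ?_) (hμ.two_pow_le x hR k)
  rw [div_lt_iff₀ hR] at hk
  rw [Metric.mem_ball] at hx hy ⊢
  have := dist_triangle y x₀ x
  rw [dist_comm x₀ x] at this
  linarith

/-- The Sobolev inequality on a doubling space supporting a Poincaré inequality, for functions
vanishing outside a bounded set. -/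
theorem IsDoublingWith.exists_sobolev [OpensMeasurableSpace α]
    [TopologicalSpace.SeparableSpace α] [SFinite μ] (hμ : IsDoublingWith μ Q)
    (huniv : μ univ = ⊤) {C_P ν p : ℝ} (hC_P : 0 < C_P) (hν : 0 < ν) (hp : 1 < p) (hpQ : p < Q)
    {Ω : Set α} (hΩ : MeasurableSet Ω) {x₀ : α} {D : ℝ} (hΩD : Ω ⊆ Metric.ball x₀ D) :
    ∃ C : ℝ≥0∞, C ≠ ⊤ ∧ ∀ (u : α → ℝ) (f : α → ℝ) (b : ℝ), Continuous u →
      (∀ x r, IntegrableOn u (Metric.ball x r) μ) → (∀ x ∉ Ω, u x = 0) → Measurable f →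
      (∀ x, 0 ≤ f x) → (∀ x, f x ≤ b) →
      PoincarePair μ C_P ν u (fun y => ENNReal.ofReal (f y)) →
      (∫⁻ x, ‖u x‖ₑ ^ sobolevExponent Q p ∂μ) ^ (1 / sobolevExponent Q p) ≤
        C * (∫⁻ x, ENNReal.ofReal (f x) ^ p ∂μ) ^ (1 / p) := by
  have hp0 : 0 < p := by linarith
  have hQ0 : 0 < Q := by linarith
  have hΩ1 : μ Ω ≠ ⊤ := ((measure_mono hΩD).trans_lt (hμ.lt_top _ _)).ne
  obtain ⟨R, hR, hbig⟩ := exists_le_measure_ball_of_measure_univ_eq_top huniv x₀ D (C := 2 * μ Ω) (by finiteness)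
  obtain ⟨c, hc0, hc⟩ := hμ.exists_pos_le_measure_ball x₀ D (mul_pos hν hR)
  obtain ⟨H, hH, hHed⟩ := exists_tsum_mul_min_le (q := Q / p) ((one_lt_div hp0).2 hpQ)
  -- The power -1/p of the constant in the lower volume bound μ(B(x, νr)) ≥ c R^(-Q) r^Q.
  set k₀ : ℝ≥0∞ := (c * ENNReal.ofReal (R ^ (-Q))) ^ (-(1 / p)) with hk₀
  have hk₀1 : k₀ ≠ ⊤ := by
    rw [hk₀, ENNReal.rpow_neg]
    refine ENNReal.inv_ne_top.2 ?_
    have : ENNReal.ofReal (R ^ (-Q)) ≠ 0 := by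
      rw [Ne, ENNReal.ofReal_eq_zero, not_le]
      positivity
    rw [Ne, ENNReal.rpow_eq_zero_iff_of_pos (by positivity)]
    exact mul_ne_zero hc0 this
  set A : ℝ≥0∞ := (2 + ENNReal.ofReal (2 ^ Q)) * (ENNReal.ofReal C_P * (H * k₀ ^ (p / Q)))
  set S : ℝ≥0∞ := ENNReal.ofReal ((2 ^ Q) ^ 3 * p * 2 ^ p / (p - 1))
  set e := sobolevExponent Q p with he
  have he0 : 0 < e := div_pos (mul_pos hp0 hQ0) (by linarith)
  have hQp : Q - p ≠ 0 := by linarith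
  refine ⟨A * S ^ (1 / e), ?_, fun u f b hu hint hu0 hf hf0 hfb hP => ?_⟩
  · have : k₀ ^ (p / Q) ≠ ⊤ := ENNReal.rpow_ne_top_of_nonneg (by positivity) hk₀1
    have : S ^ (1 / e) ≠ ⊤ := ENNReal.rpow_ne_top_of_nonneg (by positivity) ENNReal.ofReal_ne_top
    finiteness
  set g : α → ℝ≥0∞ := fun y => ENNReal.ofReal (f y)
  set I : ℝ≥0∞ := ∫⁻ x, g x ^ p ∂μ with hI
  set M := maximalFunction μ (ν * R) g with hM
  have hpt : ∀ x, ‖u x‖ₑ ≤ A * I ^ (1 / Q) * M x ^ (1 - p / Q) := by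
    intro x
    by_cases hx : x ∉ Ω
    · simp [hu0 x hx]
    rw [not_not] at hx
    refine (hμ.enorm_le_tsum hΩ hint hu0 hP hu.continuousAt hR (hbig x (hΩD hx))).trans ?_
    -- The average is at most `M x`, and by Hölder and the lower volume bound also at most a
    -- constant times r^(-Q/p): the two entries of Hedberg's minimum.
    have hterm : ∀ i : ℕ, ENNReal.ofReal (C_P * ((1 / 2) ^ i * R)) *
        ⨍⁻ y in Metric.ball x (ν * ((1 / 2) ^ i * R)), g y ∂μ ≤
        ENNReal.ofReal C_P * (ENNReal.ofReal ((1 / 2) ^ i * R) *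
          min (M x) (I ^ (1 / p) * k₀ * ENNReal.ofReal (((1 / 2) ^ i * R) ^ (-(Q / p))))) := by
      intro i
      set r : ℝ := (1 / 2) ^ i * R with hr
      have hr0 : 0 < r := by positivity
      have hrR : r ≤ R := mul_le_of_le_one_left hR.le
        (pow_le_one₀ (by norm_num) (by norm_num))
      rw [ENNReal.ofReal_mul hC_P.le, mul_assoc]
      gcongr
      refine le_min (laverage_le_maximalFunction (by gcongr)
        (Metric.mem_ball_self (by positivity))) ?_
      refine (setLAverage_le_rpow hf.ennreal_ofReal.aemeasurable hp
        (hμ.pos _ _ (by positivity)).ne' (hμ.lt_top _ _).ne).trans ?_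
      rw [mul_assoc]
      gcongr
      have hvol : c * ENNReal.ofReal (R ^ (-Q)) * ENNReal.ofReal (r ^ Q) ≤
          μ (Metric.ball x (ν * r)) := by
        have h1 := (hc x (hΩD hx)).trans_eq
          (show μ (Metric.ball x (ν * R)) = μ (Metric.ball x (2 ^ i * (ν * r))) by
            rw [hr, show (2 : ℝ) ^ i * (ν * ((1 / 2) ^ i * R)) = (2 * (1 / 2)) ^ i * (ν * R) by
              rw [mul_pow]; ring]
            norm_num)
        have h2 := h1.trans (hμ.two_pow_le x (mul_pos hν hr0) i)
        -- With r = 2^(-i) R, the factor lost in `i` doublings is exactly (R/r)^Q.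
        have h3 : ENNReal.ofReal (2 ^ Q) ^ i * ENNReal.ofReal (R ^ (-Q)) *
            ENNReal.ofReal (r ^ Q) = 1 := by
          rw [← ENNReal.ofReal_pow (by positivity), ← ENNReal.ofReal_mul (by positivity),
            ← ENNReal.ofReal_mul (by positivity), ← ENNReal.ofReal_one]
          congr 1
          rw [hr, Real.mul_rpow (by positivity) hR.le, Real.rpow_neg hR.le,
            ← Real.rpow_natCast (2 ^ Q), ← Real.rpow_natCast (1 / 2), ← Real.rpow_mul two_pos.le,
            ← Real.rpow_mul (by norm_num), mul_comm (i : ℝ) Q, one_div,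
            Real.inv_rpow two_pos.le]
          have := Real.rpow_pos_of_pos hR Q
          have := Real.rpow_pos_of_pos (two_pos (α := ℝ)) (Q * i)
          field_simp
        calc c * ENNReal.ofReal (R ^ (-Q)) * ENNReal.ofReal (r ^ Q)
            ≤ (ENNReal.ofReal (2 ^ Q) ^ i * μ (Metric.ball x (ν * r))) *
                ENNReal.ofReal (R ^ (-Q)) * ENNReal.ofReal (r ^ Q) := by gcongr
          _ = (ENNReal.ofReal (2 ^ Q) ^ i * ENNReal.ofReal (R ^ (-Q)) * ENNReal.ofReal (r ^ Q)) *
                μ (Metric.ball x (ν * r)) := by ring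
          _ = _ := by rw [h3, one_mul]
      calc μ (Metric.ball x (ν * r)) ^ (-(1 / p))
          ≤ (c * ENNReal.ofReal (R ^ (-Q)) * ENNReal.ofReal (r ^ Q)) ^ (-(1 / p)) := by
            rw [ENNReal.rpow_neg, ENNReal.rpow_neg]
            gcongr
        _ = k₀ * ENNReal.ofReal (r ^ (-(Q / p))) := by
            have hrQ : ENNReal.ofReal (r ^ Q) ≠ 0 := by
              rw [Ne, ENNReal.ofReal_eq_zero, not_le]
              positivity
            rw [ENNReal.mul_rpow_of_ne_zero ?_ hrQ, hk₀,
              ENNReal.ofReal_rpow_of_pos (by positivity), ← Real.rpow_mul hr0.le]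
            · congr 3
              ring
            · refine mul_ne_zero hc0 ?_
              rw [Ne, ENNReal.ofReal_eq_zero, not_le]
              positivity
    calc _ ≤ (2 + ENNReal.ofReal (2 ^ Q)) * ∑' i : ℕ, ENNReal.ofReal C_P *
          (ENNReal.ofReal ((1 / 2) ^ i * R) *
            min (M x) (I ^ (1 / p) * k₀ * ENNReal.ofReal (((1 / 2) ^ i * R) ^ (-(Q / p))))) := by
          gcongr _ * ?_
          exact ENNReal.tsum_le_tsum hterm
      _ ≤ (2 + ENNReal.ofReal (2 ^ Q)) * (ENNReal.ofReal C_P *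
            (H * (M x ^ (1 - 1 / (Q / p)) * (I ^ (1 / p) * k₀) ^ (1 / (Q / p))))) := by
          rw [ENNReal.tsum_mul_left]
          gcongr
          exact hHed _ _ _ hR
      _ = _ := by
          rw [one_div_div, ENNReal.mul_rpow_of_nonneg _ _ (by positivity), ← ENNReal.rpow_mul,
            show 1 / p * (p / Q) = 1 / Q by field_simp]
          ring
  -- With the Sobolev exponent, the pointwise bound raised to the power `e` involves precisely `M ^
  -- p`.
  have hexp : (1 - p / Q) * e = p := by
    rw [he, sobolevExponent]
    field_simp
  calc (∫⁻ x, ‖u x‖ₑ ^ e ∂μ) ^ (1 / e)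
      ≤ (∫⁻ x, (A * I ^ (1 / Q)) ^ e * M x ^ p ∂μ) ^ (1 / e) := by
        gcongr with x
        refine (ENNReal.rpow_le_rpow (hpt x) he0.le).trans_eq ?_
        rw [ENNReal.mul_rpow_of_nonneg _ _ he0.le, ← ENNReal.rpow_mul, hexp]
    _ = A * I ^ (1 / Q) * (∫⁻ x, M x ^ p ∂μ) ^ (1 / e) := by
        rw [lintegral_const_mul _ ((measurable_maximalFunction g).pow_const p),
          ENNReal.mul_rpow_of_nonneg _ _ (by positivity), ← ENNReal.rpow_mul,
          mul_one_div_cancel he0.ne', ENNReal.rpow_one]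
    _ ≤ A * I ^ (1 / Q) * (S * I) ^ (1 / e) := by
        gcongr
        exact hμ.strong_type_maximalFunction hp hf hf0 hfb
    _ = _ := by
        rw [ENNReal.mul_rpow_of_nonneg _ _ (by positivity)]
        have : I ^ (1 / p) = I ^ (1 / Q) * I ^ (1 / e) := by
          rw [← ENNReal.rpow_add_of_nonneg _ _ (by positivity) (by positivity)]
          congr 1
          rw [he, sobolevExponent]
          field_simp
          ring
        rw [this]
        ring

end Sobolev

end

/-! ### The Sobolev inequality for vector fields -/

noncomputable section

/-- Control balls are not assumed relatively compact, and doubling in `[0, ∞]` does not by itself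
exclude infinite measure. A small ball is finite by local finiteness, and doubling propagates this
to all radii. -/
lemma measure_ball_lt_top_of_doubling {α : Type*} [PseudoMetricSpace α] [MeasurableSpace α]
    {μ : Measure α} [IsLocallyFiniteMeasure μ] {K : ℝ≥0∞} (hK : K ≠ ⊤)
    (h : ∀ x r, 0 < r → μ (Metric.ball x (2 * r)) ≤ K * μ (Metric.ball x r)) (x : α) (r : ℝ) :
    μ (Metric.ball x r) < ⊤ := by
  obtain ⟨s, hs, hs'⟩ := μ.finiteAt_nhds x
  obtain ⟨r₀, hr₀, hr₀s⟩ := Metric.mem_nhds_iff.1 hs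
  have hpow : ∀ n : ℕ, μ (Metric.ball x (2 ^ n * r₀)) < ⊤ := by
    intro n
    induction n with
    | zero => simpa using (measure_mono hr₀s).trans_lt hs'
    | succ n ih =>
      rw [pow_succ', mul_assoc]
      exact (h x _ (by positivity)).trans_lt (ENNReal.mul_lt_top hK.lt_top ih)
  obtain ⟨n, hn⟩ := pow_unbounded_of_one_lt (r / r₀) one_lt_two
  exact (measure_mono (Metric.ball_subset_ball ((div_lt_iff₀ hr₀).1 hn).le)).trans_lt (hpow n)

lemma IsCompact.exists_subset_ball {α : Type*} [PseudoMetricSpace α] {s : Set α}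
    (hs : IsCompact s) (x₀ : α) : ∃ D : ℝ, s ⊆ Metric.ball x₀ D :=
  ((Metric.isBounded_iff_subset_ball x₀).1 hs.isBounded)

variable {N d : ℕ} {X : Fin d → EuclideanSpace ℝ (Fin N) → EuclideanSpace ℝ (Fin N)} {Q p : ℝ}
  {Ω : Set (EuclideanSpace ℝ (Fin N))}

lemma continuous_xGrad (hX : ∀ j, Continuous (X j)) {u : EuclideanSpace ℝ (Fin N) → ℝ}
    (hu : ContDiff ℝ 1 u) : Continuous (xGrad X u) := by
  refine (PiLp.continuous_toLp 2 _).comp (continuous_pi fun j => ?_)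
  exact (hu.continuous_fderiv one_ne_zero).clm_apply (hX j)

lemma xGrad_eq_zero {u : EuclideanSpace ℝ (Fin N) → ℝ} {x : EuclideanSpace ℝ (Fin N)}
    (hx : x ∉ tsupport u) : xGrad X u x = 0 := by
  have : fderiv ℝ u x = 0 := by
    by_contra h
    exact hx (support_fderiv_subset ℝ h)
  ext j
  simp [xGrad, this]

lemma hasCompactSupport_xGrad {u : EuclideanSpace ℝ (Fin N) → ℝ} (hu : HasCompactSupport u) :
    HasCompactSupport (xGrad X u) :=
  HasCompactSupport.intro hu fun _ hx => xGrad_eq_zero hx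

lemma GeometricAssumptions.isDoublingWith (hX : GeometricAssumptions X Q) :
    @IsDoublingWith _ hX.ccPseudoMetricSpace _ volume Q := by
  have hle : ∀ x r, 0 < r → volume (@Metric.ball _ hX.ccPseudoMetricSpace x (2 * r)) ≤
      ENNReal.ofReal (2 ^ Q) * volume (@Metric.ball _ hX.ccPseudoMetricSpace x r) := by
    intro x r hr
    rw [hX.ball_eq, hX.ball_eq]
    exact (hX.doubling x r hr).2
  refine @IsDoublingWith.mk _ hX.ccPseudoMetricSpace _ _ _ (fun x r hr => ?_) ?_ hle
  · rw [hX.ball_eq, show r = 2 * (r / 2) by ring]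
    exact (hX.doubling x (r / 2) (half_pos hr)).1
  · exact @measure_ball_lt_top_of_doubling _ hX.ccPseudoMetricSpace _ _
      (inferInstanceAs (IsLocallyFiniteMeasure (volume : Measure (EuclideanSpace ℝ (Fin N)))))
      _ ENNReal.ofReal_ne_top hle

/-- The Sobolev inequality for test functions. -/
theorem GeometricAssumptions.exists_sobolev_test (hX : GeometricAssumptions X Q) (hN : 0 < N)
    (hΩ : IsOpen Ω) (hΩb : Bornology.IsBounded Ω) (hp : 1 < p) (hpQ : p < Q) :
    ∃ C : ℝ≥0∞, C ≠ ⊤ ∧ ∀ φ : EuclideanSpace ℝ (Fin N) → ℝ, ContDiff ℝ ∞ φ →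
      HasCompactSupport φ → tsupport φ ⊆ Ω →
      eLpNorm φ (ENNReal.ofReal (sobolevExponent Q p)) (volume.restrict Ω) ≤
        C * eLpNorm (xGrad X φ) (ENNReal.ofReal p) (volume.restrict Ω) := by
  obtain ⟨C_P, ν, hC_P, hν, hP⟩ := hX.poincare
  have : Nonempty (Fin N) := ⟨⟨0, hN⟩⟩
  have : NoncompactSpace (EuclideanSpace ℝ (Fin N)) := NormedSpace.noncompactSpace ℝ _
  -- Infinite total volume provides, around each point of Ω, a ball with at least twice the measure
  -- of Ω.
  have huniv : (volume : Measure (EuclideanSpace ℝ (Fin N))) univ = ⊤ :=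
    measure_univ_of_isAddLeftInvariant _
  obtain ⟨D, hD⟩ := @IsCompact.exists_subset_ball _ hX.ccPseudoMetricSpace _
    hΩb.isCompact_closure 0
  obtain ⟨C, hC, H⟩ := @IsDoublingWith.exists_sobolev _ hX.ccPseudoMetricSpace _ volume Q
    (inferInstanceAs (OpensMeasurableSpace (EuclideanSpace ℝ (Fin N))))
    (inferInstanceAs (TopologicalSpace.SeparableSpace (EuclideanSpace ℝ (Fin N)))) inferInstance
    hX.isDoublingWith huniv C_P ν p hC_P hν hp hpQ Ω hΩ.measurableSet 0 D
    (subset_closure.trans hD)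
  refine ⟨C, hC, fun φ hφ hφc hφΩ => ?_⟩
  have hgc : Continuous (xGrad X φ) :=
    continuous_xGrad (fun j => (hX.locallyLipschitz j).continuous) (hφ.of_le (by simp))
  obtain ⟨b, hb⟩ := (hasCompactSupport_xGrad (X := X) hφc).exists_bound_of_continuous hgc
  have hint : Integrable φ volume := hφ.continuous.integrable_of_hasCompactSupport hφc
  have hmain := H φ (fun x => ‖xGrad X φ x‖) b hφ.continuous (fun x r => hint.integrableOn)
    (fun x hx => image_eq_zero_of_notMem_tsupport fun h => hx (hφΩ h)) hgc.norm.measurable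
    (fun _ => norm_nonneg _) hb (by
      intro x r hr
      have := hP x r hr φ univ isOpen_univ (subset_univ _) (hφ.of_le (by simp)).contDiffOn
        hint.integrableOn
      rw [hX.ball_eq, hX.ball_eq]
      simpa only [ofReal_norm] using this)
  simp only [ofReal_norm] at hmain
  have he : 0 < sobolevExponent Q p :=
    div_pos (mul_pos (by linarith) (by linarith)) (by linarith)
  rw [eLpNorm_restrict_eq_of_support_subset
      ((subset_tsupport φ).trans hφΩ),
    eLpNorm_restrict_eq_of_support_subset (f := xGrad X φ)
      (fun x hx => hφΩ (by_contra fun h => hx (xGrad_eq_zero h))),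
    eLpNorm_eq_lintegral_rpow_enorm_toReal (by simpa using he) ENNReal.ofReal_ne_top,
    eLpNorm_eq_lintegral_rpow_enorm_toReal (by simpa using (by linarith)) ENNReal.ofReal_ne_top,
    ENNReal.toReal_ofReal he.le, ENNReal.toReal_ofReal (by linarith)]
  exact hmain

/-- The `q`-seminorm is lower semicontinuous under convergence in measure, so the bound passes from
the approximating test functions to their limit. -/
lemma IsSobolevZero.eLpNorm_le_of_test {u : EuclideanSpace ℝ (Fin N) → ℝ}
    {V : EuclideanSpace ℝ (Fin N) → EuclideanSpace ℝ (Fin d)} (hX : ∀ j, Continuous (X j))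
    (hp : 1 ≤ p) {C q : ℝ≥0∞} (hC : C ≠ ⊤)
    (H : ∀ φ : EuclideanSpace ℝ (Fin N) → ℝ, ContDiff ℝ ∞ φ →
      HasCompactSupport φ → tsupport φ ⊆ Ω → eLpNorm φ q (volume.restrict Ω) ≤
        C * eLpNorm (xGrad X φ) (ENNReal.ofReal p) (volume.restrict Ω))
    (hu : IsSobolevZero X Ω p u V) :
    eLpNorm u q (volume.restrict Ω) ≤ C * eLpNorm V (ENNReal.ofReal p) (volume.restrict Ω) := by
  obtain ⟨hum, hVm, φ, hφ, hφu, hφV⟩ := hu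
  have hp1 : (1 : ℝ≥0∞) ≤ ENNReal.ofReal p := by simpa using ENNReal.ofReal_le_ofReal hp
  have hmeas := tendstoInMeasure_of_tendsto_eLpNorm (f := φ) (g := u)
    (zero_lt_one.trans_le hp1).ne' (fun n => (hφ n).1.continuous.aestronglyMeasurable)
    hum.aestronglyMeasurable hφu
  have hlim : Tendsto (fun n => C * (eLpNorm (fun x => xGrad X (φ n) x - V x) (ENNReal.ofReal p)
      (volume.restrict Ω) + eLpNorm V (ENNReal.ofReal p) (volume.restrict Ω))) atTop
      (𝓝 (C * eLpNorm V (ENNReal.ofReal p) (volume.restrict Ω))) := by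
    refine ENNReal.Tendsto.const_mul ?_ (Or.inr hC)
    simpa using hφV.add_const (eLpNorm V (ENNReal.ofReal p) (volume.restrict Ω))
  refine le_of_forall_gt_imp_ge_of_dense fun c hc => ?_
  have hbound : ∀ᶠ n in atTop, eLpNorm (φ n) q (volume.restrict Ω) ≤ c := by
    filter_upwards [hlim.eventually (gt_mem_nhds hc)] with n hn
    refine ((H (φ n) (hφ n).1 (hφ n).2.1 (hφ n).2.2).trans ?_).trans hn.le
    gcongr
    have hg := (continuous_xGrad hX ((hφ n).1.of_le (m := 1) (by simp))).aestronglyMeasurable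
      (μ := volume.restrict Ω)
    have := eLpNorm_add_le (hg.sub hVm.aestronglyMeasurable) hVm.aestronglyMeasurable hp1
    rw [sub_add_cancel] at this
    exact this
  exact eLpNorm_le_of_tendstoInMeasure hbound hmeas
    fun n => (hφ n).1.continuous.aestronglyMeasurable

end

/-! ### The chain rule in the Sobolev space -/

noncomputable section

/-- Dominated convergence to zero in `L^p`. -/
lemma tendsto_eLpNorm_zero_of_dominated {α E : Type*} [MeasurableSpace α] {μ : Measure α}
    [NormedAddCommGroup E] {F : ℕ → α → E} {b : α → ℝ} {p : ℝ} (hp : 0 < p)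
    (hF : ∀ n, AEStronglyMeasurable (F n) μ) (hb : MemLp b (ENNReal.ofReal p) μ)
    (hle : ∀ n, ∀ᵐ x ∂μ, ‖F n x‖ ≤ b x)
    (hlim : ∀ᵐ x ∂μ, Tendsto (fun n => F n x) atTop (𝓝 0)) :
    Tendsto (fun n => eLpNorm (F n) (ENNReal.ofReal p) μ) atTop (𝓝 0) := by
  have hp0 : ENNReal.ofReal p ≠ 0 := by simpa using hp
  simp_rw [eLpNorm_eq_lintegral_rpow_enorm_toReal hp0 ENNReal.ofReal_ne_top,
    ENNReal.toReal_ofReal hp.le]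
  have hfin : ∫⁻ x, ‖b x‖ₑ ^ p ∂μ ≠ ⊤ := by
    have := lintegral_rpow_enorm_lt_top_of_eLpNorm_lt_top hp0 ENNReal.ofReal_ne_top hb.2
    rw [ENNReal.toReal_ofReal hp.le] at this
    exact this.ne
  have h := tendsto_lintegral_of_dominated_convergence' (μ := μ) (f := fun _ => 0)
    (F := fun n x => ‖F n x‖ₑ ^ p) (fun x => ‖b x‖ₑ ^ p)
    (fun n => (hF n).enorm.pow_const p) (fun n => by
      filter_upwards [hle n] with x hx
      refine ENNReal.rpow_le_rpow ?_ hp.le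
      rw [enorm_le_iff_norm_le]
      exact hx.trans (le_abs_self _)) hfin (by
      filter_upwards [hlim] with x hx
      have := (ENNReal.continuous_rpow_const (y := p)).continuousAt.tendsto.comp hx.enorm
      simpa [hp, Function.comp_def] using this)
  have h' := (ENNReal.continuous_rpow_const (y := 1 / p)).continuousAt.tendsto.comp h
  simpa [hp, Function.comp_def] using h'

variable {N d : ℕ} {X : Fin d → EuclideanSpace ℝ (Fin N) → EuclideanSpace ℝ (Fin N)} {p : ℝ}
  {Ω : Set (EuclideanSpace ℝ (Fin N))} {u : EuclideanSpace ℝ (Fin N) → ℝ}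
  {V : EuclideanSpace ℝ (Fin N) → EuclideanSpace ℝ (Fin d)}

lemma xGrad_comp {G : ℝ → ℝ} (hG : Differentiable ℝ G) (hu : Differentiable ℝ u)
    (x : EuclideanSpace ℝ (Fin N)) :
    xGrad X (fun y => G (u y)) x = deriv G (u x) • xGrad X u x := by
  ext j
  have := ((hG (u x)).hasDerivAt.comp_hasFDerivAt x (hu x).hasFDerivAt).fderiv
  simp only [Function.comp_def] at this
  simp [xGrad, this]

/-- `W^{1,p}_0(Ω, X)` is closed under convergence of functions and gradients in `L^p`. -/
lemma isSobolevZero_of_tendsto (hX : ∀ j, Continuous (X j)) (hp : 1 ≤ p)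
    (hu : MemLp u (ENNReal.ofReal p) (volume.restrict Ω))
    (hV : MemLp V (ENNReal.ofReal p) (volume.restrict Ω))
    {v : ℕ → EuclideanSpace ℝ (Fin N) → ℝ}
    {W : ℕ → EuclideanSpace ℝ (Fin N) → EuclideanSpace ℝ (Fin d)}
    (h : ∀ n, IsSobolevZero X Ω p (v n) (W n))
    (hv : Tendsto (fun n => eLpNorm (fun x => v n x - u x) (ENNReal.ofReal p) (volume.restrict Ω))
      atTop (𝓝 0))
    (hW : Tendsto (fun n => eLpNorm (fun x => W n x - V x) (ENNReal.ofReal p) (volume.restrict Ω))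
      atTop (𝓝 0)) : IsSobolevZero X Ω p u V := by
  have hp1 : (1 : ℝ≥0∞) ≤ ENNReal.ofReal p := by simpa using ENNReal.ofReal_le_ofReal hp
  -- Diagonal choice of a test function within 1/n of the n-th element; at n = 0 the tolerance is
  -- `⊤`.
  have hex : ∀ n : ℕ, ∃ φ : EuclideanSpace ℝ (Fin N) → ℝ,
      (ContDiff ℝ ∞ φ ∧ HasCompactSupport φ ∧ tsupport φ ⊆ Ω) ∧
      eLpNorm (fun x => φ x - v n x) (ENNReal.ofReal p) (volume.restrict Ω) < (n : ℝ≥0∞)⁻¹ ∧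
      eLpNorm (fun x => xGrad X φ x - W n x) (ENNReal.ofReal p) (volume.restrict Ω) <
        (n : ℝ≥0∞)⁻¹ := by
    intro n
    obtain ⟨-, -, φ, hφ, hφ1, hφ2⟩ := h n
    have hpos : (0 : ℝ≥0∞) < (n : ℝ≥0∞)⁻¹ := by simp
    obtain ⟨k, hk1, hk2⟩ := ((hφ1.eventually (gt_mem_nhds hpos)).and
      (hφ2.eventually (gt_mem_nhds hpos))).exists
    exact ⟨φ k, hφ k, hk1, hk2⟩
  choose φ hφ hφ1 hφ2 using hex
  refine ⟨hu, hV, φ, hφ, ?_, ?_⟩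
  · refine tendsto_of_tendsto_of_tendsto_of_le_of_le tendsto_const_nhds
      (by simpa using ENNReal.tendsto_inv_nat_nhds_zero.add hv) (fun _ => zero_le) fun n => ?_
    have h1 := (hφ n).1.continuous.aestronglyMeasurable (μ := volume.restrict Ω)
    have h2 := (h n).1.aestronglyMeasurable
    have := eLpNorm_add_le (h1.sub h2) (h2.sub hu.aestronglyMeasurable) hp1
    rw [sub_add_sub_cancel] at this
    exact this.trans (add_le_add (hφ1 n).le le_rfl)
  · refine tendsto_of_tendsto_of_tendsto_of_le_of_le tendsto_const_nhds
      (by simpa using ENNReal.tendsto_inv_nat_nhds_zero.add hW) (fun _ => zero_le) fun n => ?_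
    have h1 := (continuous_xGrad hX ((hφ n).1.of_le (m := 1) (by simp))).aestronglyMeasurable
      (μ := volume.restrict Ω)
    have h2 := (h n).2.1.aestronglyMeasurable
    have := eLpNorm_add_le (h1.sub h2) (h2.sub hV.aestronglyMeasurable) hp1
    rw [sub_add_sub_cancel] at this
    exact this.trans (add_le_add (hφ2 n).le le_rfl)

/-- The chain rule in `W^{1,p}_0(Ω, X)` for smooth functions with bounded derivative. -/
lemma IsSobolevZero.comp_smooth (hX : ∀ j, Continuous (X j)) (hp : 1 ≤ p)
    (h : IsSobolevZero X Ω p u V) {G : ℝ → ℝ} (hG : ContDiff ℝ ∞ G) (hG0 : G 0 = 0) {L : ℝ}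
    (hL : ∀ t, |deriv G t| ≤ L) :
    IsSobolevZero X Ω p (fun x => G (u x)) (fun x => deriv G (u x) • V x) := by
  have hp1 : (1 : ℝ≥0∞) ≤ ENNReal.ofReal p := by simpa using ENNReal.ofReal_le_ofReal hp
  have hL0 : 0 ≤ L := (abs_nonneg _).trans (hL 0)
  have hGd : Differentiable ℝ G := hG.differentiable (by simp)
  have hG'c : Continuous (deriv G) := hG.continuous_deriv (by simp)
  have hlip : ∀ s t, ‖G s - G t‖ ≤ L * ‖s - t‖ := fun s t =>
    convex_univ.norm_image_sub_le_of_norm_deriv_le (fun x _ => hGd x) (fun x _ => hL x)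
      (mem_univ t) (mem_univ s)
  obtain ⟨hu, hV, φ, hφ, hφu, hφV⟩ := h
  have hum := hu.aestronglyMeasurable
  have hVm := hV.aestronglyMeasurable
  have hG'u : AEStronglyMeasurable (fun x => deriv G (u x)) (volume.restrict Ω) :=
    hG'c.comp_aestronglyMeasurable hum
  -- Almost everywhere convergence along a subsequence is what dominated convergence needs for the
  -- term (G'(φ) - G'(u))V.
  obtain ⟨ns, hns, hae⟩ := (tendstoInMeasure_of_tendsto_eLpNorm (f := φ) (g := u)
    (zero_lt_one.trans_le hp1).ne' (fun n => (hφ n).1.continuous.aestronglyMeasurable)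
    hum hφu).exists_seq_tendsto_ae
  have hgm : ∀ n, AEStronglyMeasurable (xGrad X (φ n)) (volume.restrict Ω) := fun n =>
    (continuous_xGrad hX ((hφ n).1.of_le (m := 1) (by simp))).aestronglyMeasurable
  refine ⟨hu.of_le_mul (c := L) (hG.continuous.comp_aestronglyMeasurable hum) ?_,
    hV.of_le_mul (c := L) (hG'u.smul hVm) ?_, fun n x => G (φ (ns n) x), fun n => ⟨?_, ?_, ?_⟩,
    ?_, ?_⟩
  · refine Eventually.of_forall fun x => ?_
    simpa [hG0] using hlip (u x) 0
  · refine Eventually.of_forall fun x => ?_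
    rw [norm_smul]
    gcongr
    exact hL _
  · exact hG.comp (hφ _).1
  · exact (hφ (ns n)).2.1.comp_left hG0
  · exact (tsupport_comp_subset hG0 _).trans (hφ (ns n)).2.2
  · refine tendsto_of_tendsto_of_tendsto_of_le_of_le tendsto_const_nhds (h := fun n =>
      ENNReal.ofReal L * eLpNorm (fun x => φ (ns n) x - u x) (ENNReal.ofReal p)
        (volume.restrict Ω)) ?_ (fun _ => zero_le) fun n => ?_
    · simpa using ENNReal.Tendsto.const_mul (hφu.comp hns.tendsto_atTop)
        (Or.inr ENNReal.ofReal_ne_top)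
    · exact eLpNorm_le_mul_eLpNorm_of_ae_le_mul (Eventually.of_forall fun x => hlip _ _) _
  · have h1 : Tendsto (fun n => ENNReal.ofReal L * eLpNorm (fun x => xGrad X (φ (ns n)) x - V x)
        (ENNReal.ofReal p) (volume.restrict Ω)) atTop (𝓝 0) := by
      simpa using ENNReal.Tendsto.const_mul (hφV.comp hns.tendsto_atTop)
        (Or.inr ENNReal.ofReal_ne_top)
    have h2 : Tendsto (fun n => eLpNorm (fun x => (deriv G (φ (ns n) x) - deriv G (u x)) • V x)
        (ENNReal.ofReal p) (volume.restrict Ω)) atTop (𝓝 0) := by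
      refine tendsto_eLpNorm_zero_of_dominated (by linarith) (fun n => ?_)
        (hV.norm.const_mul (2 * L)) (fun n => Eventually.of_forall fun x => ?_) ?_
      · exact ((hG'c.comp (hφ _).1.continuous).aestronglyMeasurable.sub hG'u).smul hVm
      · rw [norm_smul]
        gcongr
        refine (norm_sub_le _ _).trans ?_
        rw [two_mul]
        exact add_le_add (hL _) (hL _)
      · filter_upwards [hae] with x hx
        have := ((hG'c.tendsto (u x)).comp hx).sub_const (deriv G (u x))
        rw [sub_self] at this
        simpa using this.smul_const (V x)
    refine tendsto_of_tendsto_of_tendsto_of_le_of_le tendsto_const_nhds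
      (by simpa using h1.add h2) (fun _ => zero_le) fun n => ?_
    have e : (fun x => xGrad X (fun y => G (φ (ns n) y)) x - deriv G (u x) • V x) =
        (fun x => deriv G (φ (ns n) x) • (xGrad X (φ (ns n)) x - V x)) +
          fun x => (deriv G (φ (ns n) x) - deriv G (u x)) • V x := by
      ext1 x
      rw [xGrad_comp hGd ((hφ _).1.differentiable (by simp))]
      simp only [Pi.add_apply, smul_sub, sub_smul]
      abel
    have hm1 : AEStronglyMeasurable (fun x => deriv G (φ (ns n) x)) (volume.restrict Ω) :=
      (hG'c.comp (hφ _).1.continuous).aestronglyMeasurable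
    simp only [e]
    refine (eLpNorm_add_le (hm1.smul ((hgm _).sub hVm)) ((hm1.sub hG'u).smul hVm) hp1).trans
      (add_le_add ?_ le_rfl)
    refine eLpNorm_le_mul_eLpNorm_of_ae_le_mul (Eventually.of_forall fun x => ?_) _
    rw [Pi.smul_apply', norm_smul]
    exact mul_le_mul_of_nonneg_right (hL _) (norm_nonneg _)

/-- The chain rule in `W^{1,p}_0(Ω, X)` for primitives of bounded continuous functions. -/
theorem IsSobolevZero.comp_primitive (hX : ∀ j, Continuous (X j)) (hp : 1 ≤ p)
    (h : IsSobolevZero X Ω p u V) {g : ℝ → ℝ} (hg : Continuous g) {L : ℝ} (hL : ∀ t, |g t| ≤ L) :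
    IsSobolevZero X Ω p (fun x => ∫ t in 0..u x, g t) (fun x => g (u x) • V x) := by
  have hL0 : 0 ≤ L := (abs_nonneg _).trans (hL 0)
  have hu := h.1
  have hV := h.2.1
  have hpos : ∀ n : ℕ, (0 : ℝ) < 1 / (n + 1) := fun n => by positivity
  -- Smooth approximations whose error at a point is controlled by the local oscillation of `g`.
  -- Global oscillation at most 2L gives the uniform bound 3L; continuity gives pointwise
  -- convergence.
  choose γ hγ hγd using fun n : ℕ =>
    hg.exists_contDiff_dist_le_of_forall_mem_ball_dist_le (hpos n)
  have hγb : ∀ n t, |γ n t| ≤ 3 * L := by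
    intro n t
    have h1 := hγd n t (2 * L) fun x _ => by
      rw [Real.dist_eq]
      linarith [abs_sub (g x) (g t), hL x, hL t]
    rw [Real.dist_eq] at h1
    linarith [abs_sub_abs_le_abs_sub (γ n t) (g t), hL t]
  have hγlim : ∀ t, Tendsto (fun n => γ n t) atTop (𝓝 (g t)) := by
    intro t
    rw [Metric.tendsto_atTop]
    intro ε hε
    obtain ⟨δ, hδ, hδ'⟩ := Metric.continuous_iff.1 hg t (ε / 2) (half_pos hε)
    obtain ⟨n₀, hn₀⟩ := exists_nat_one_div_lt hδ
    refine ⟨n₀, fun n hn => ?_⟩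
    refine lt_of_le_of_lt (hγd n t (ε / 2) fun x hx => (hδ' x ?_).le) (half_lt_self hε)
    exact (Metric.mem_ball.1 hx).trans ((Nat.one_div_le_one_div hn).trans_lt hn₀)
  set G : ℕ → ℝ → ℝ := fun n s => ∫ t in 0..s, γ n t with hG
  have hGder : ∀ n s, HasDerivAt (G n) (γ n s) s := fun n s =>
    intervalIntegral.integral_hasDerivAt_right ((hγ n).continuous.intervalIntegrable _ _)
      ((hγ n).continuous.stronglyMeasurableAtFilter _ _) (hγ n).continuous.continuousAt
  have hGder' : ∀ n, deriv (G n) = γ n := fun n => funext fun s => (hGder n s).deriv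
  have hint : ∀ f : ℝ → ℝ, ∀ K : ℝ, (∀ t, |f t| ≤ K) → ∀ s, ‖∫ t in 0..s, f t‖ ≤ K * ‖s‖ := by
    intro f K hf s
    simpa using intervalIntegral.norm_integral_le_of_norm_le_const (a := 0) (b := s)
      (f := f) (C := K) (fun t _ => hf t)
  have hprim : Continuous fun s => ∫ t in 0..s, g t :=
    intervalIntegral.continuous_primitive (fun a b => hg.intervalIntegrable a b) 0
  have hum := hu.aestronglyMeasurable
  have hVm := hV.aestronglyMeasurable
  have hgu : AEStronglyMeasurable (fun x => g (u x)) (volume.restrict Ω) :=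
    hg.comp_aestronglyMeasurable hum
  refine isSobolevZero_of_tendsto hX hp
    (v := fun n x => G n (u x)) (W := fun n x => γ n (u x) • V x) ?_ ?_ (fun n => ?_) ?_ ?_
  · exact hu.of_le_mul (c := L) (hprim.comp_aestronglyMeasurable hum)
      (Eventually.of_forall fun x => hint g L hL (u x))
  · refine hV.of_le_mul (c := L) (hgu.smul hVm) (Eventually.of_forall fun x => ?_)
    rw [norm_smul]
    gcongr
    exact hL _
  · have := h.comp_smooth hX hp (G := G n) (contDiff_infty_iff_deriv.2
      ⟨fun s => (hGder n s).differentiableAt, by rw [hGder']; exact hγ n⟩) (by simp [hG])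
      (L := 3 * L) (by rw [hGder']; exact hγb n)
    rw [hGder'] at this
    exact this
  · refine tendsto_eLpNorm_zero_of_dominated (by linarith) (fun n => ?_)
      (hu.norm.const_mul (4 * L)) (fun n => Eventually.of_forall fun x => ?_)
      (Eventually.of_forall fun x => ?_)
    · have hGc : Continuous (G n) :=
        continuous_iff_continuousAt.2 fun s => (hGder n s).continuousAt
      exact (hGc.comp_aestronglyMeasurable hum).sub (hprim.comp_aestronglyMeasurable hum)
    · refine (norm_sub_le _ _).trans ?_
      linarith [hint g L hL (u x), hint (γ n) _ (hγb n) (u x)]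
    · have : Tendsto (fun n => G n (u x)) atTop (𝓝 (∫ t in 0..u x, g t)) :=
        intervalIntegral.tendsto_integral_filter_of_dominated_convergence (fun _ => 3 * L)
          (Eventually.of_forall fun n => (hγ n).continuous.aestronglyMeasurable)
          (Eventually.of_forall fun n => Eventually.of_forall fun t _ => hγb n t)
          intervalIntegrable_const (Eventually.of_forall fun t _ => hγlim t)
      simpa using this.sub_const (∫ t in 0..u x, g t)
  · refine tendsto_eLpNorm_zero_of_dominated (by linarith) (fun n => ?_)
      (hV.norm.const_mul (4 * L)) (fun n => Eventually.of_forall fun x => ?_)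
      (Eventually.of_forall fun x => ?_)
    · exact (((hγ n).continuous.comp_aestronglyMeasurable hum).smul hVm).sub (hgu.smul hVm)
    · rw [← sub_smul, norm_smul]
      gcongr
      refine (norm_sub_le _ _).trans ?_
      simp only [Real.norm_eq_abs]
      linarith [hL (u x), hγb n (u x)]
    · simpa using ((hγlim (u x)).smul_const (V x)).sub_const (g (u x) • V x)

end

/-! ### Truncated powers and the energy inequality -/

noncomputable section

/-- The composition of a Carathéodory function with a measurable function is measurable. -/
lemma aestronglyMeasurable_of_caratheodory {α E F : Type*} [MeasurableSpace α] {μ : Measure α}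
    [TopologicalSpace E] [NormedAddCommGroup F] {a : α → E → F}
    (hm : ∀ ξ, AEStronglyMeasurable (fun x => a x ξ) μ) (hc : ∀ᵐ x ∂μ, Continuous (a x))
    {w : α → E} (hw : AEStronglyMeasurable w μ) :
    AEStronglyMeasurable (fun x => a x (w x)) μ := by
  -- For simple functions the composition is a finite sum of measurable pieces; continuity in ξ
  -- carries this to the limit.
  set φ := hw.stronglyMeasurable_mk.approx with hφ
  refine aestronglyMeasurable_of_tendsto_ae atTop (f := fun n x => a x (φ n x)) (fun n => ?_) ?_
  · have e : (fun x => a x (φ n x)) =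
        fun x => ∑ y ∈ (φ n).range, (φ n ⁻¹' {y}).indicator (fun x => a x y) x := by
      ext x
      rw [Finset.sum_eq_single (φ n x)]
      · rw [indicator_of_mem (by simp)]
      · intro y _ hy
        exact indicator_of_notMem (fun h => hy (by simpa using h.symm)) _
      · exact fun h => absurd (SimpleFunc.mem_range_self _ x) h
    rw [e]
    exact Finset.aestronglyMeasurable_fun_sum _ fun y _ =>
      (hm y).indicator ((φ n).measurableSet_fiber y)
  · filter_upwards [hc, hw.ae_eq_mk] with x hx hxw
    rw [hxw]
    exact (hx.tendsto _).comp (hw.stronglyMeasurable_mk.tendsto_approx x)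

section TruncatedPower

/-- The truncated power `min(|t|, k)^q`. -/
def truncPow (q k t : ℝ) : ℝ := min |t| k ^ q

variable {q k p t : ℝ}

lemma truncPow_nonneg (hk : 0 ≤ k) : 0 ≤ truncPow q k t :=
  Real.rpow_nonneg (le_min (abs_nonneg _) hk) _

lemma continuous_truncPow (hq : 0 ≤ q) : Continuous (truncPow q k) :=
  (continuous_abs.min continuous_const).rpow_const fun _ => Or.inr hq

lemma truncPow_le (hq : 0 ≤ q) (hk : 0 ≤ k) : truncPow q k t ≤ k ^ q :=
  Real.rpow_le_rpow (le_min (abs_nonneg _) hk) (min_le_right _ _) hq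

lemma truncPow_neg : truncPow q k (-t) = truncPow q k t := by simp [truncPow]

lemma abs_integral_eq_of_even {f : ℝ → ℝ} (hf : ∀ t, f (-t) = f t) (h0 : ∀ t, 0 ≤ f t) (t : ℝ) :
    |∫ τ in 0..t, f τ| = ∫ τ in 0..|t|, f τ := by
  have hpos : ∀ s, 0 ≤ s → 0 ≤ ∫ τ in 0..s, f τ := fun s hs =>
    intervalIntegral.integral_nonneg hs fun _ _ => h0 _
  rcases le_total 0 t with ht | ht
  · rw [abs_of_nonneg ht, abs_of_nonneg (hpos t ht)]
  · have e : ∫ τ in 0..t, f τ = -∫ τ in 0..-t, f τ := by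
      have := intervalIntegral.integral_comp_neg (a := 0) (b := t) f
      simp only [hf, neg_zero] at this
      rw [this, intervalIntegral.integral_symm]
    rw [abs_of_nonpos ht, e, abs_neg, abs_of_nonneg (hpos _ (by linarith))]

/-- Up to min(|t|, k) the integrand is the plain power, and beyond it is nonnegative. This turns
bounds on the primitive into bounds on the truncated solution. -/
lemma min_rpow_le_integral_truncPow (hq : 0 ≤ q) (hk : 0 ≤ k) (t : ℝ) :
    min |t| k ^ (q + 1) ≤ (q + 1) * |∫ τ in 0..t, truncPow q k τ| := by
  rw [abs_integral_eq_of_even (fun _ => truncPow_neg) (fun _ => truncPow_nonneg hk)]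
  have hm : 0 ≤ min |t| k := le_min (abs_nonneg _) hk
  have h1 : ∫ τ in 0..min |t| k, truncPow q k τ ≤ ∫ τ in 0..|t|, truncPow q k τ :=
    intervalIntegral.integral_mono_interval le_rfl hm (min_le_left _ _)
      (Eventually.of_forall fun _ => truncPow_nonneg hk)
      ((continuous_truncPow hq).intervalIntegrable _ _)
  have h2 : ∫ τ in 0..min |t| k, truncPow q k τ = min |t| k ^ (q + 1) / (q + 1) := by
    have e : ∫ τ in 0..min |t| k, truncPow q k τ = ∫ τ in 0..min |t| k, τ ^ q := by
      refine intervalIntegral.integral_congr fun τ hτ => ?_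
      rw [uIcc_of_le hm] at hτ
      simp only [truncPow]
      rw [abs_of_nonneg hτ.1, min_eq_left (hτ.2.trans (min_le_right _ _))]
    rw [e, integral_rpow (Or.inl (by linarith)), Real.zero_rpow (by linarith), sub_zero]
  rw [h2, div_le_iff₀ (by linarith)] at h1
  linarith

/-- The weight is nondecreasing in |t|, so p - 1 of its p factors may be frozen at the endpoint,
where `min_rpow_le_integral_truncPow` bounds them by a power of the primitive. The constant does not
depend on `k`. -/
lemma abs_integral_truncPow_rpow_le (hq : 0 ≤ q) (hk : 0 ≤ k) (hp : 1 ≤ p) (t : ℝ) :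
    |∫ τ in 0..t, truncPow q k τ ^ p| ≤ (q + 1) ^ (q * (p - 1) / (q + 1)) *
      |∫ τ in 0..t, truncPow q k τ| ^ (q * (p - 1) / (q + 1) + 1) := by
  set H := |∫ τ in 0..t, truncPow q k τ| with hH
  set e := q * (p - 1) / (q + 1) with he
  have he0 : 0 ≤ e := div_nonneg (mul_nonneg hq (by linarith)) (by linarith)
  have hH0 : 0 ≤ H := abs_nonneg _
  have hm : 0 ≤ min |t| k := le_min (abs_nonneg _) hk
  have hw : truncPow q k t ^ (p - 1) ≤ (q + 1) ^ e * H ^ e := by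
    rw [← Real.mul_rpow (by linarith) hH0]
    calc truncPow q k t ^ (p - 1) = (min |t| k ^ (q + 1)) ^ e := by
          rw [truncPow, ← Real.rpow_mul hm, ← Real.rpow_mul hm, he]
          congr 1
          field_simp
      _ ≤ _ := Real.rpow_le_rpow (Real.rpow_nonneg hm _)
          (min_rpow_le_integral_truncPow hq hk t) he0
  have hHe : H = ∫ τ in 0..|t|, truncPow q k τ :=
    abs_integral_eq_of_even (fun _ => truncPow_neg) (fun _ => truncPow_nonneg hk) t
  rw [abs_integral_eq_of_even (fun _ => by rw [truncPow_neg])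
    (fun _ => Real.rpow_nonneg (truncPow_nonneg hk) _)]
  have hcont : Continuous fun τ => truncPow q k τ ^ p :=
    (continuous_truncPow hq).rpow_const fun _ => Or.inr (by linarith)
  calc ∫ τ in 0..|t|, truncPow q k τ ^ p
      ≤ ∫ τ in 0..|t|, truncPow q k t ^ (p - 1) * truncPow q k τ := by
        refine intervalIntegral.integral_mono_on (abs_nonneg _)
          (hcont.intervalIntegrable _ _)
          ((continuous_const.mul (continuous_truncPow hq)).intervalIntegrable _ _) fun τ hτ => ?_
        have h0 : 0 ≤ truncPow q k τ := truncPow_nonneg hk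
        have e1 : truncPow q k τ ^ p = truncPow q k τ ^ (p - 1) * truncPow q k τ := by
          nth_rewrite 3 [← Real.rpow_one (truncPow q k τ)]
          rw [← Real.rpow_add_of_nonneg h0 (by linarith) zero_le_one, sub_add_cancel]
        rw [e1]
        gcongr
        rw [truncPow, truncPow, abs_of_nonneg hτ.1]
        have := hτ.1
        have := hτ.2
        gcongr
    _ = truncPow q k t ^ (p - 1) * H := by
        rw [intervalIntegral.integral_const_mul, hHe]
    _ ≤ (q + 1) ^ e * H ^ e * H := by gcongr
    _ = _ := by
        rw [Real.rpow_add_of_nonneg hH0 he0 zero_le_one, Real.rpow_one, mul_assoc]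

end TruncatedPower

section Energy

variable {N d : ℕ} {X : Fin d → EuclideanSpace ℝ (Fin N) → EuclideanSpace ℝ (Fin N)}
  {p α β : ℝ} {Ω : Set (EuclideanSpace ℝ (Fin N))} {h f u : EuclideanSpace ℝ (Fin N) → ℝ}
  {V W : EuclideanSpace ℝ (Fin N) → EuclideanSpace ℝ (Fin d)}
  {a : EuclideanSpace ℝ (Fin N) → ℝ → EuclideanSpace ℝ (Fin d) → EuclideanSpace ℝ (Fin d)}

lemma memLp_norm_rpow_sub_one {E F : Type*} [MeasurableSpace E] [NormedAddCommGroup F]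
    {μ : Measure E} {v : E → F} (hp : 1 < p) (hv : MemLp v (ENNReal.ofReal p) μ) :
    MemLp (fun x => ‖v x‖ ^ (p - 1)) (ENNReal.ofReal (p / (p - 1))) μ := by
  have := hv.norm_rpow_div (ENNReal.ofReal (p - 1))
  rwa [ENNReal.toReal_ofReal (by linarith), ← ENNReal.ofReal_div_of_pos (by linarith)] at this

lemma LerayLions.aestronglyMeasurable (ha : LerayLions Ω p α β h a)
    (hu : AEStronglyMeasurable u (volume.restrict Ω))
    (hV : AEStronglyMeasurable V (volume.restrict Ω)) :
    AEStronglyMeasurable (fun x => a x (u x) (V x)) (volume.restrict Ω) :=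
  aestronglyMeasurable_of_caratheodory
    (a := fun x (q : ℝ × EuclideanSpace ℝ (Fin d)) => a x q.1 q.2)
    (fun q => ha.measurable q.1 q.2) ha.continuous (hu.prodMk hV)

/-- The only use of the growth condition: it places the flux in the dual space L^{p'}, without
entering any estimate. -/
lemma LerayLions.memLp (ha : LerayLions Ω p α β h a) (hp : 1 < p)
    (hu : MemLp u (ENNReal.ofReal p) (volume.restrict Ω))
    (hV : MemLp V (ENNReal.ofReal p) (volume.restrict Ω)) :
    MemLp (fun x => a x (u x) (V x)) (ENNReal.ofReal (p / (p - 1))) (volume.restrict Ω) := by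
  refine MemLp.mono' (((ha.h_memLp.add (memLp_norm_rpow_sub_one hp hu)).add
    (memLp_norm_rpow_sub_one hp hV)).const_mul β)
    (ha.aestronglyMeasurable hu.aestronglyMeasurable hV.aestronglyMeasurable) ?_
  filter_upwards [ha.growth] with x hx
  exact hx _ _

lemma LerayLions.integrable_inner (ha : LerayLions Ω p α β h a) (hp : 1 < p)
    (hu : MemLp u (ENNReal.ofReal p) (volume.restrict Ω))
    (hV : MemLp V (ENNReal.ofReal p) (volume.restrict Ω))
    (hW : MemLp W (ENNReal.ofReal p) (volume.restrict Ω)) :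
    Integrable (fun x => inner ℝ (a x (u x) (V x)) (W x)) (volume.restrict Ω) := by
  have hA := ha.memLp hp hu hV
  have hpq : Real.HolderConjugate (p / (p - 1)) p := (Real.HolderConjugate.conjExponent hp).symm
  have : ENNReal.HolderConjugate (ENNReal.ofReal (p / (p - 1))) (ENNReal.ofReal p) :=
    hpq.ennrealOfReal
  refine (hA.norm.integrable_mul hW.norm).mono'
    (hA.aestronglyMeasurable.inner hW.aestronglyMeasurable) (Eventually.of_forall fun x => ?_)
  exact norm_inner_le_norm _ _

/-- Testing the equation with a primitive of `g ≥ 0` evaluated at `u`. -/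
lemma LerayLions.energy_le (ha : LerayLions Ω p α β h a) (hX : ∀ j, Continuous (X j))
    (hp : 1 < p) (hα : 0 < α) (hu : IsSobolevZero X Ω p u V)
    (hweak : ∀ (v : EuclideanSpace ℝ (Fin N) → ℝ)
      (W : EuclideanSpace ℝ (Fin N) → EuclideanSpace ℝ (Fin d)), IsSobolevZero X Ω p v W →
        ∫ x in Ω, inner ℝ (a x (u x) (V x)) (W x) = ∫ x in Ω, f x * v x)
    {g : ℝ → ℝ} (hg : Continuous g) (hg0 : ∀ t, 0 ≤ g t) {L : ℝ} (hL : ∀ t, g t ≤ L) :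
    ENNReal.ofReal α * ∫⁻ x in Ω, ENNReal.ofReal (g (u x)) * ‖V x‖ₑ ^ p ≤
      ∫⁻ x in Ω, ‖f x‖ₑ * ‖∫ t in 0..u x, g t‖ₑ := by
  have hv := hu.comp_primitive hX hp.le hg (L := L) fun t => by
    rw [abs_of_nonneg (hg0 t)]
    exact hL t
  have hint := ha.integrable_inner hp hu.1 hu.2.1 hv.2.1
  have hpt : ∀ᵐ x ∂(volume.restrict Ω),
      α * (g (u x) * ‖V x‖ ^ p) ≤ inner ℝ (a x (u x) (V x)) (g (u x) • V x) := by
    filter_upwards [ha.coercive] with x hx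
    rw [inner_smul_right]
    nlinarith [mul_le_mul_of_nonneg_left (hx (u x) (V x)) (hg0 (u x))]
  have hnn : ∀ x, 0 ≤ α * (g (u x) * ‖V x‖ ^ p) := fun x =>
    mul_nonneg hα.le (mul_nonneg (hg0 _) (Real.rpow_nonneg (norm_nonneg _) _))
  calc ENNReal.ofReal α * ∫⁻ x in Ω, ENNReal.ofReal (g (u x)) * ‖V x‖ₑ ^ p
      = ∫⁻ x in Ω, ENNReal.ofReal (α * (g (u x) * ‖V x‖ ^ p)) := by
        rw [← lintegral_const_mul' _ _ ENNReal.ofReal_ne_top]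
        refine lintegral_congr fun x => ?_
        rw [ENNReal.ofReal_mul hα.le, ENNReal.ofReal_mul (hg0 _),
          ← ENNReal.ofReal_rpow_of_nonneg (norm_nonneg _) (by linarith), ofReal_norm]
    _ ≤ ∫⁻ x in Ω, ENNReal.ofReal (inner ℝ (a x (u x) (V x)) (g (u x) • V x)) := by
        refine lintegral_mono_ae ?_
        filter_upwards [hpt] with x hx
        exact ENNReal.ofReal_le_ofReal hx
    _ = ENNReal.ofReal (∫ x in Ω, inner ℝ (a x (u x) (V x)) (g (u x) • V x)) := by
        refine (ofReal_integral_eq_lintegral_ofReal hint ?_).symm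
        filter_upwards [hpt] with x hx
        exact (hnn x).trans hx
    _ = ENNReal.ofReal (∫ x in Ω, f x * ∫ t in 0..u x, g t) := by rw [hweak _ _ hv]
    -- Integrability of the right-hand side is not needed: without it the Bochner integral is 0 and
    -- the bound still holds.
    _ ≤ ‖∫ x in Ω, f x * ∫ t in 0..u x, g t‖ₑ := Real.ofReal_le_enorm _
    _ ≤ ∫⁻ x in Ω, ‖f x * ∫ t in 0..u x, g t‖ₑ := enorm_integral_le_lintegral_enorm _
    _ = _ := by simp_rw [enorm_mul]

end Energy

end

/-! ### The a priori estimate -/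

noncomputable section

/-- Absorption of the smaller power by division; finiteness of `A` is essential, since `⊤` may
satisfy the hypothesis. -/
lemma ENNReal.le_rpow_of_rpow_le_mul_rpow {A D : ℝ≥0∞} (hA : A ≠ ⊤) {p σ : ℝ} (hσ : σ < p)
    (h : A ^ p ≤ D * A ^ σ) : A ≤ D ^ (1 / (p - σ)) := by
  rcases eq_or_ne A 0 with rfl | hA0
  · exact zero_le
  have hσ0 : A ^ σ ≠ 0 := by simp [ENNReal.rpow_eq_zero_iff, hA0, hA]
  have hσ1 : A ^ σ ≠ ⊤ := by simp [ENNReal.rpow_eq_top_iff, hA0, hA]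
  have h1 : A ^ (p - σ) ≤ D := by
    rw [ENNReal.rpow_sub _ _ hA0 hA]
    exact ENNReal.div_le_of_le_mul h
  rw [one_div, ENNReal.le_rpow_inv_iff (by linarith)]
  exact h1

section Estimate

variable {N d : ℕ} {X : Fin d → EuclideanSpace ℝ (Fin N) → EuclideanSpace ℝ (Fin N)}
  {p α β : ℝ} {Ω : Set (EuclideanSpace ℝ (Fin N))} {h f u : EuclideanSpace ℝ (Fin N) → ℝ}
  {V : EuclideanSpace ℝ (Fin N) → EuclideanSpace ℝ (Fin d)}
  {a : EuclideanSpace ℝ (Fin N) → ℝ → EuclideanSpace ℝ (Fin d) → EuclideanSpace ℝ (Fin d)}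

/-- The estimate obtained by testing with truncated powers of the solution. -/
lemma LerayLions.eLpNorm_truncated_le (ha : LerayLions Ω p α β h a) (hX : ∀ j, Continuous (X j))
    (hp : 1 < p) (hα : 0 < α) (hu : IsSobolevZero X Ω p u V)
    (hweak : ∀ (v : EuclideanSpace ℝ (Fin N) → ℝ)
      (W : EuclideanSpace ℝ (Fin N) → EuclideanSpace ℝ (Fin d)), IsSobolevZero X Ω p v W →
        ∫ x in Ω, inner ℝ (a x (u x) (V x)) (W x) = ∫ x in Ω, f x * v x)
    {C : ℝ≥0∞} (hC : C ≠ ⊤) {e : ℝ} (he : 0 < e)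
    (hS : ∀ (v : EuclideanSpace ℝ (Fin N) → ℝ)
      (W : EuclideanSpace ℝ (Fin N) → EuclideanSpace ℝ (Fin d)), IsSobolevZero X Ω p v W →
        eLpNorm v (ENNReal.ofReal e) (volume.restrict Ω) ≤
          C * eLpNorm W (ENNReal.ofReal p) (volume.restrict Ω))
    {m q k : ℝ} (hm : 1 < m) (hf : MemLp f (ENNReal.ofReal m) (volume.restrict Ω)) (hq : 0 ≤ q)
    (hk : 0 ≤ k) (hexp : e = (q * (p - 1) / (q + 1) + 1) * (m / (m - 1))) :
    eLpNorm (fun x => ∫ t in 0..u x, truncPow q k t) (ENNReal.ofReal e) (volume.restrict Ω) ≤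
      (C ^ p * (ENNReal.ofReal α)⁻¹ * ENNReal.ofReal ((q + 1) ^ (q * (p - 1) / (q + 1))) *
        eLpNorm f (ENNReal.ofReal m) (volume.restrict Ω)) ^ ((q + 1) / (p - 1)) := by
  set σ := q * (p - 1) / (q + 1) + 1 with hσ
  have hp0 : 0 < p := by linarith
  have hm0 : 0 < m := by linarith
  have hm1 : 0 < m - 1 := by linarith
  have hp1 : 0 < p - 1 := by linarith
  have hσ0 : 0 < σ := by positivity
  set H : EuclideanSpace ℝ (Fin N) → ℝ := fun x => ∫ t in 0..u x, truncPow q k t with hH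
  set G : EuclideanSpace ℝ (Fin N) → ℝ := fun x => ∫ t in 0..u x, truncPow q k t ^ p with hG
  set F := eLpNorm f (ENNReal.ofReal m) (volume.restrict Ω) with hF
  set c := ENNReal.ofReal ((q + 1) ^ (q * (p - 1) / (q + 1))) with hc
  set A := eLpNorm H (ENNReal.ofReal e) (volume.restrict Ω) with hA
  have hw0 : ∀ t, 0 ≤ truncPow q k t := fun t => truncPow_nonneg hk
  have hHs := hu.comp_primitive hX hp.le (continuous_truncPow (k := k) hq) (L := k ^ q)
    fun t => by rw [abs_of_nonneg (hw0 t)]; exact truncPow_le hq hk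
  have hHm : AEStronglyMeasurable H (volume.restrict Ω) := hHs.1.aestronglyMeasurable
  have hAS := hS _ _ hHs
  -- Truncation puts H in W^{1,p}_0, so its norm is finite a priori; absorption below depends on
  -- this.
  have hAtop : A ≠ ⊤ := ne_top_of_le_ne_top (ENNReal.mul_ne_top hC hHs.2.1.2.ne) hAS
  have hgc : Continuous fun t => truncPow q k t ^ p :=
    (continuous_truncPow hq).rpow_const fun _ => Or.inr hp0.le
  -- The weight of the test function is the p-th power of the weight in XH, so the energy is exactly
  -- ‖XH‖_p^p.
  have hen := ha.energy_le hX hp hα hu hweak hgc (fun t => Real.rpow_nonneg (hw0 t) _)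
    (L := (k ^ q) ^ p) fun t => Real.rpow_le_rpow (hw0 t) (truncPow_le hq hk) hp0.le
  have hGm : AEStronglyMeasurable G (volume.restrict Ω) :=
    (intervalIntegral.continuous_primitive (fun a b => hgc.intervalIntegrable a b) 0
      ).comp_aestronglyMeasurable hu.1.aestronglyMeasurable
  have hAe : A = (∫⁻ x in Ω, ‖H x‖ₑ ^ e) ^ (1 / e) := by
    rw [hA, eLpNorm_eq_lintegral_rpow_enorm_toReal (by simpa using he) ENNReal.ofReal_ne_top,
      ENNReal.toReal_ofReal he.le]
  have hgrad : eLpNorm (fun x => truncPow q k (u x) • V x) (ENNReal.ofReal p)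
      (volume.restrict Ω) ^ p =
      ∫⁻ x in Ω, ENNReal.ofReal (truncPow q k (u x) ^ p) * ‖V x‖ₑ ^ p := by
    rw [eLpNorm_eq_lintegral_rpow_enorm_toReal (by simpa using hp0) ENNReal.ofReal_ne_top,
      ENNReal.toReal_ofReal hp0.le, ← ENNReal.rpow_mul, one_div_mul_cancel hp0.ne',
      ENNReal.rpow_one]
    refine lintegral_congr fun x => ?_
    rw [enorm_smul, ENNReal.mul_rpow_of_nonneg _ _ hp0.le,
      ← ENNReal.ofReal_rpow_of_nonneg (hw0 _) hp0.le, Real.enorm_of_nonneg (hw0 _)]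
  have hGH : ∀ x, ‖G x‖ₑ ≤ c * ‖H x‖ₑ ^ σ := by
    intro x
    have := abs_integral_truncPow_rpow_le hq hk hp.le (u x)
    rw [← ofReal_norm, ← ofReal_norm, ENNReal.ofReal_rpow_of_nonneg (norm_nonneg _) hσ0.le, hc,
      ← ENNReal.ofReal_mul (by positivity)]
    exact ENNReal.ofReal_le_ofReal this
  have hrhs : ∫⁻ x in Ω, ‖f x‖ₑ * ‖G x‖ₑ ≤ F * (c * A ^ σ) := by
    have hpq : m.HolderConjugate (m / (m - 1)) := Real.HolderConjugate.conjExponent hm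
    have hm' : 0 < m / (m - 1) := by positivity
    refine (ENNReal.lintegral_mul_le_Lp_mul_Lq (volume.restrict Ω) hpq
      hf.aestronglyMeasurable.enorm hGm.enorm).trans ?_
    have hFe : F = (∫⁻ x in Ω, ‖f x‖ₑ ^ m) ^ (1 / m) := by
      rw [hF, eLpNorm_eq_lintegral_rpow_enorm_toReal (by simpa using hm0) ENNReal.ofReal_ne_top,
        ENNReal.toReal_ofReal hm0.le]
    rw [hFe]
    gcongr
    calc (∫⁻ x in Ω, ‖G x‖ₑ ^ (m / (m - 1))) ^ (1 / (m / (m - 1)))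
        ≤ (∫⁻ x in Ω, c ^ (m / (m - 1)) * ‖H x‖ₑ ^ e) ^ (1 / (m / (m - 1))) := by
          gcongr with x
          refine (ENNReal.rpow_le_rpow (hGH x) hm'.le).trans_eq ?_
          rw [ENNReal.mul_rpow_of_nonneg _ _ hm'.le, ← ENNReal.rpow_mul, hexp]
      _ = c * A ^ σ := by
          rw [lintegral_const_mul'' _ (hHm.enorm.pow_const e),
            ENNReal.mul_rpow_of_nonneg _ _ (by positivity), ← ENNReal.rpow_mul,
            mul_one_div_cancel hm'.ne', ENNReal.rpow_one, hAe, ← ENNReal.rpow_mul]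
          congr 2
          rw [hexp]
          field_simp
  have hα0 : ENNReal.ofReal α ≠ 0 := by simpa using hα
  have hkey : A ^ p ≤ (C ^ p * (ENNReal.ofReal α)⁻¹ * c * F) * A ^ σ := by
    calc A ^ p ≤ C ^ p * ∫⁻ x in Ω, ENNReal.ofReal (truncPow q k (u x) ^ p) * ‖V x‖ₑ ^ p := by
          rw [← hgrad, ← ENNReal.mul_rpow_of_nonneg _ _ hp0.le]
          exact ENNReal.rpow_le_rpow hAS hp0.le
      _ = C ^ p * ((ENNReal.ofReal α)⁻¹ * (ENNReal.ofReal α *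
            ∫⁻ x in Ω, ENNReal.ofReal (truncPow q k (u x) ^ p) * ‖V x‖ₑ ^ p)) := by
          rw [← mul_assoc (ENNReal.ofReal α)⁻¹, ENNReal.inv_mul_cancel hα0 ENNReal.ofReal_ne_top,
            one_mul]
      _ ≤ C ^ p * ((ENNReal.ofReal α)⁻¹ * (F * (c * A ^ σ))) := by
          gcongr _ * (_ * ?_)
          exact hen.trans hrhs
      _ = _ := by ring
  -- Positivity of this difference permits absorption; its inverse is the exponent in the
  -- conclusion.
  have hpσ : p - σ = (p - 1) / (q + 1) := by
    rw [hσ]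
    field_simp
    ring
  have hfin := ENNReal.le_rpow_of_rpow_le_mul_rpow hAtop
    (sub_pos.1 (hpσ ▸ div_pos hp1 (by linarith))) hkey
  rwa [hpσ, one_div_div] at hfin

/-- The summability estimate deduced from a Sobolev inequality. -/
lemma LerayLions.eLpNorm_le (ha : LerayLions Ω p α β h a) (hX : ∀ j, Continuous (X j))
    (hp : 1 < p) (hα : 0 < α) (hu : IsSobolevZero X Ω p u V)
    (hweak : ∀ (v : EuclideanSpace ℝ (Fin N) → ℝ)
      (W : EuclideanSpace ℝ (Fin N) → EuclideanSpace ℝ (Fin d)), IsSobolevZero X Ω p v W →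
        ∫ x in Ω, inner ℝ (a x (u x) (V x)) (W x) = ∫ x in Ω, f x * v x)
    {C : ℝ≥0∞} (hC : C ≠ ⊤) {e : ℝ} (he : 0 < e)
    (hS : ∀ (v : EuclideanSpace ℝ (Fin N) → ℝ)
      (W : EuclideanSpace ℝ (Fin N) → EuclideanSpace ℝ (Fin d)), IsSobolevZero X Ω p v W →
        eLpNorm v (ENNReal.ofReal e) (volume.restrict Ω) ≤
          C * eLpNorm W (ENNReal.ofReal p) (volume.restrict Ω))
    {m q : ℝ} (hm : 1 < m) (hf : MemLp f (ENNReal.ofReal m) (volume.restrict Ω)) (hq : 0 ≤ q)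
    (hexp : e = (q * (p - 1) / (q + 1) + 1) * (m / (m - 1))) :
    eLpNorm u (ENNReal.ofReal (e * (q + 1))) (volume.restrict Ω) ≤
      ENNReal.ofReal (q + 1) ^ (1 / (q + 1)) *
        (C ^ p * (ENNReal.ofReal α)⁻¹ *
          ENNReal.ofReal ((q + 1) ^ (q * (p - 1) / (q + 1)))) ^ (1 / (p - 1)) *
        eLpNorm f (ENNReal.ofReal m) (volume.restrict Ω) ^ (1 / (p - 1)) := by
  have hp1 : 0 < p - 1 := by linarith
  have hq1 : 0 < q + 1 := by linarith
  set K := C ^ p * (ENNReal.ofReal α)⁻¹ * ENNReal.ofReal ((q + 1) ^ (q * (p - 1) / (q + 1)))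
  set F := eLpNorm f (ENNReal.ofReal m) (volume.restrict Ω)
  have hum := hu.1.aestronglyMeasurable
  have hn : ∀ n : ℕ, eLpNorm (fun x => min |u x| (n : ℝ) ^ (q + 1)) (ENNReal.ofReal e)
      (volume.restrict Ω) ≤ ENNReal.ofReal (q + 1) * (K * F) ^ ((q + 1) / (p - 1)) := by
    intro n
    refine (eLpNorm_le_mul_eLpNorm_of_ae_le_mul (Eventually.of_forall fun x => ?_) _).trans
      (mul_le_mul_right (ha.eLpNorm_truncated_le hX hp hα hu hweak hC he hS hm hf hq
        n.cast_nonneg hexp) _)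
    rw [Real.norm_of_nonneg (Real.rpow_nonneg (le_min (abs_nonneg _) n.cast_nonneg) _)]
    exact min_rpow_le_integral_truncPow hq n.cast_nonneg _
  have hlim : eLpNorm (fun x => ‖u x‖ ^ (q + 1)) (ENNReal.ofReal e) (volume.restrict Ω) ≤
      ENNReal.ofReal (q + 1) * (K * F) ^ ((q + 1) / (p - 1)) := by
    -- The bound is uniform in the truncation level, and at each point the truncations are
    -- eventually constant.
    refine Lp.eLpNorm_le_of_ae_tendsto (u := atTop) (Eventually.of_forall hn) (fun n => ?_)
      (Eventually.of_forall fun x => ?_)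
    · exact ((continuous_abs.min continuous_const).rpow_const
        fun _ => Or.inr hq1.le).comp_aestronglyMeasurable hum
    · refine tendsto_const_nhds.congr' ?_
      obtain ⟨n₀, hn₀⟩ := exists_nat_ge |u x|
      filter_upwards [eventually_ge_atTop n₀] with n hn
      rw [min_eq_left (hn₀.trans (by exact_mod_cast hn)), Real.norm_eq_abs]
  rw [eLpNorm_norm_rpow _ hq1, ← ENNReal.ofReal_mul he.le] at hlim
  calc eLpNorm u (ENNReal.ofReal (e * (q + 1))) (volume.restrict Ω)
      ≤ (ENNReal.ofReal (q + 1) * (K * F) ^ ((q + 1) / (p - 1))) ^ (1 / (q + 1)) :=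
        by rwa [one_div, ENNReal.le_rpow_inv_iff hq1]
    _ = _ := by
        rw [ENNReal.mul_rpow_of_nonneg _ _ (by positivity), ← ENNReal.rpow_mul,
          show (q + 1) / (p - 1) * (1 / (q + 1)) = 1 / (p - 1) by field_simp,
          ENNReal.mul_rpow_of_nonneg _ _ (by positivity), mul_assoc]

end Estimate

end

/-! ### Choice of exponents and conclusion -/

theorem theorem4p2 {N d : ℕ} (hN : 2 ≤ N) (hd : 2 ≤ d)
    (X : Fin d → EuclideanSpace ℝ (Fin N) → EuclideanSpace ℝ (Fin N)) (Q : ℝ)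
    (hX : GeometricAssumptions X Q)
    (Ω : Set (EuclideanSpace ℝ (Fin N))) (hΩ : IsOpen Ω) (hΩb : Bornology.IsBounded Ω)
    (p α m s : ℝ) (hp : 1 < p) (hpQ : p < Q) (hα : 0 < α)
    (hm : lowerSobolevExponent Q p ≤ m) (hmQ : m < Q / p)
    (hs : s = m * (p - 1) * Q / (Q - m * p)) :
    s = sobolevExponent Q (sobolevExponent Q m * (p - 1)) ∧
    ∃ C : ℝ, 0 < C ∧
      ∀ (β : ℝ) (h : EuclideanSpace ℝ (Fin N) → ℝ)
        (a : EuclideanSpace ℝ (Fin N) → ℝ → EuclideanSpace ℝ (Fin d) → EuclideanSpace ℝ (Fin d))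
        (f u : EuclideanSpace ℝ (Fin N) → ℝ),
        0 < β → LerayLions Ω p α β h a →
        MemLp f (ENNReal.ofReal m) (volume.restrict Ω) →
        IsWeakSolution X Ω p a f u →
          MemLp u (ENNReal.ofReal s) (volume.restrict Ω) ∧
          eLpNorm u (ENNReal.ofReal s) (volume.restrict Ω) ≤
            ENNReal.ofReal C *
              eLpNorm f (ENNReal.ofReal m) (volume.restrict Ω) ^ (1 / (p - 1)) := by
  have hp0 : 0 < p := by linarith
  have hp1 : 0 < p - 1 := by linarith
  have hQ0 : 0 < Q := by linarith
  have hQp : 0 < Q - p := by linarith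
  have hden : 0 < Q * (p - 1) + p := by positivity
  have hm1 : 1 < m := by
    refine lt_of_lt_of_le ?_ hm
    rw [lowerSobolevExponent, one_lt_div hden]
    linarith
  have hmp : 0 < Q - m * p := by
    rw [lt_div_iff₀ hp0] at hmQ
    linarith
  have hQm : 0 < Q - m := by nlinarith
  have hm1' : 0 < m - 1 := by linarith
  refine ⟨?_, ?_⟩
  · have h1 : Q - m * Q / (Q - m) * (p - 1) = Q * (Q - m * p) / (Q - m) := by
      field_simp
      ring
    rw [hs, sobolevExponent, sobolevExponent, h1]
    field_simp
  -- The solution of σm' = p^*; the same value gives p^*(q + 1) = s.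
  set q : ℝ := m * (p - 1) * (Q - p) / (p * (Q - m * p)) - 1 with hq
  -- After clearing denominators this is m(Q(p-1) + p) ≥ pQ, that is m ≥ p_*; equality corresponds
  -- to q = 0.
  have hq0 : 0 ≤ q := by
    rw [hq, sub_nonneg, le_div_iff₀ (by positivity)]
    rw [lowerSobolevExponent, div_le_iff₀ hden] at hm
    nlinarith
  have hq1 : q + 1 = m * (p - 1) * (Q - p) / (p * (Q - m * p)) := by rw [hq]; ring
  have hq1pos : 0 < q + 1 := by linarith
  set e := sobolevExponent Q p with he
  have he0 : 0 < e := div_pos (by positivity) hQp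
  have hes : e * (q + 1) = s := by
    rw [hq1, he, hs, sobolevExponent]
    field_simp
  have hexp : e = (q * (p - 1) / (q + 1) + 1) * (m / (m - 1)) := by
    have h1 : q * (p - 1) / (q + 1) + 1 = p - (p - 1) / (q + 1) := by
      field_simp
      ring
    rw [h1, hq1, he, sobolevExponent]
    field_simp
    ring
  have hXc : ∀ j, Continuous (X j) := fun j => (hX.locallyLipschitz j).continuous
  obtain ⟨C, hC, hS⟩ := hX.exists_sobolev_test (by omega) hΩ hΩb hp hpQ
  set K : ℝ≥0∞ := ENNReal.ofReal (q + 1) ^ (1 / (q + 1)) *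
    (C ^ p * (ENNReal.ofReal α)⁻¹ *
      ENNReal.ofReal ((q + 1) ^ (q * (p - 1) / (q + 1)))) ^ (1 / (p - 1)) with hK
  have hKtop : K ≠ ⊤ := by
    have h1 : C ^ p ≠ ⊤ := ENNReal.rpow_ne_top_of_nonneg hp0.le hC
    have h2 : (ENNReal.ofReal α)⁻¹ ≠ ⊤ := ENNReal.inv_ne_top.2 (by simpa using hα)
    exact ENNReal.mul_ne_top (ENNReal.rpow_ne_top_of_nonneg (by positivity) ENNReal.ofReal_ne_top)
      (ENNReal.rpow_ne_top_of_nonneg (by positivity)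
        (ENNReal.mul_ne_top (ENNReal.mul_ne_top h1 h2) ENNReal.ofReal_ne_top))
  -- Adding 1 only ensures that the constant is positive.
  refine ⟨K.toReal + 1, by positivity, fun β h a f u _ ha hf hu => ?_⟩
  obtain ⟨V, huV, hweak⟩ := hu
  have hmain := ha.eLpNorm_le hXc hp hα huV hweak hC he0
    (fun v W hv => hv.eLpNorm_le_of_test hXc hp.le hC hS) hm1 hf hq0 hexp
  rw [hes] at hmain
  have hbound : eLpNorm u (ENNReal.ofReal s) (volume.restrict Ω) ≤
      ENNReal.ofReal (K.toReal + 1) *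
        eLpNorm f (ENNReal.ofReal m) (volume.restrict Ω) ^ (1 / (p - 1)) := by
    refine hmain.trans ?_
    gcongr
    exact (ENNReal.le_ofReal_iff_toReal_le hKtop (by positivity)).2 (by linarith)
  refine ⟨⟨huV.1.aestronglyMeasurable, hbound.trans_lt ?_⟩, hbound⟩
  exact ENNReal.mul_lt_top ENNReal.ofReal_lt_top
    (ENNReal.rpow_lt_top_of_nonneg (by positivity) hf.2.ne)
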